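/- **Setting.** Let $\mathcal S\subset\mathbb R^{m}$ and $\mathcal A\subset\mathbb R^{k}$ ($m,k\ge 1$, $d=m+k$) be compact rectangles with non-empty interior and $\mathcal X=\mathcal S\times\mathcal A$. Let $q(s'\mid s,a)$ be a transition probability density on $\mathcal S$, let $\pi(a\mid s)$ (target) and $\nu(a\mid s)$ be stationary policies with densities on $\mathcal A$, let $\mu_0$ be an initial state density and $0\le\gamma<1$. Let $q^\nu_t$ be the density of $(S_t,A_t)$ when $S_0\sim\mu_0$ and the actions follow $\nu$, and let $d^\nu_T=\frac1{H(T)}\sum_{t<H(T)}q^\nu_t$ be the average visitation density over $H(T)\ge 1$ decision points (for instance $H(T)=T$, or a constant, in which case $d^\nu$ does not depend on $T$). Assume that there are positive constants with $p_{\min}\le d^\nu_T(s,a)\le p_{1,\max}$ for all $(s,a)\in\mathcal X$ and $T\ge1$, that $\pi(\cdot\mid s)$ is absolutely continuous with respect to $\nu(\cdot\mid s)$ for every $s$, and that $q(s'\mid s,a)\,\pi(a'\mid s')\le p_{2,\max}$ for all $s,a,s',a'$. For a function $Q$ on $\mathcal X$ put $h^\pi(s,a,s';Q)=Q(s,a)-\gamma\int_{\mathcal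 A}\pi(a'\mid s')Q(s',a')\,da'$. For a measurable, Lebesgue integrable function $v$ on $\mathcal X$, let $\mathcal P_T(Q,v)$ be the set of all probability laws $P$ of a tuple $(S,A,R,S')$ such that $(S,A)$ has density $d^\nu_T$, $S'$ given $(S,A)$ has density $q(\cdot\mid S,A)$, and $$R=h^\pi(S,A,S';Q)+U,\qquad \mathbb E[U\mid S,A]=0,\qquad \mathbb E[U^2\mid S,A]=v(S,A).$$ For $p,L>0$ let $\Lambda_2(p,L)$ be the ball of radius $L$ in the Sobolev space of smoothness $p$ on $\mathcal X$ with respect to Lebesgue measure (with the norm $\|g\|^2=\sum_{|\beta|\le\lfloor p\rfloor}\|\partial^\beta g\|_2^2$, plus, if $p\notin\mathbb N$, $\sum_{|\beta|=\lfloor p\rfloor}\iint_{\mathcal X\times\mathcal X}\frac{|\partial^\beta g(x)-\partial^\beta g(y)|^2}{|x-y|^{d+2(p-\lfloor p\rfloor)}}\,dx\,dy$). Derivatives are weak derivatives, and $\|\cdot\|_2$ is the norm of $L^2(\mathcal X)$ with Lebesgue measure; $\|\partial^\alpha\widehat Q-\partial^\alpha Q\|_2=\infty$ if $\partial^\alpha\widehat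 Q$ does not exist. **Theorem 3.** Let $p,L,\sigma>0$ and let $\alpha\in\mathbb N^d$ be a multi-index with $0\le|\alpha|<p$, where $|\alpha|=\sum_i\alpha_i$. There are constants $\bar c>0$ and $\bar c'>0$ such that, for every measurable, integrable $v$ with $v\ge\sigma^2$ on $\mathcal X$, $$\liminf_{NT\to\infty}\ \inf_{\widehat Q}\ \sup_{Q\in\Lambda_2(p,L)}\ \sup_{P\in\mathcal P_T(Q,v)} P^{\otimes NT}\Big(\big\|\partial^\alpha\widehat Q-\partial^\alpha Q\big\|_2\ \ge\ \bar c\,(NT)^{(|\alpha|-p)/(2p+d)}\Big)\ \ge\ \bar c'>0 ,$$ where the data $\{(S_{i,t},A_{i,t},R_{i,t},S'_{i,t})\}_{1\le i\le N,\,0\le t<T}$ are i.i.d. with law $P$ and the infimum is over all estimators, i.e. all jointly measurable functions $\widehat Q$ of the data and of $(s,a)$. -/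

import Mathlib

open MeasureTheory Filter
open scoped ENNReal ContDiff

noncomputable section

namespace QMinimax

/-! ### Weak derivatives and Sobolev balls in `ι → ℝ` -/

section Sobolev

variable {ι : Type} [Fintype ι] [DecidableEq ι]

/-- The classical partial derivative in the `i`-th coordinate. -/
def partialDeriv (i : ι) (φ : (ι → ℝ) → ℝ) : (ι → ℝ) → ℝ :=
  fun x => fderiv ℝ φ x (Pi.single i 1)

/-- The iterated partial derivative `∂^α φ` for a multi-index `α`. It is only applied to smooth `φ`,
for which the order in which the coordinates are listed is irrelevant. -/
def multiDeriv (α : ι → ℕ) (φ : (ι → ℝ) → ℝ) : (ι → ℝ) → ℝ :=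
  (Finset.univ : Finset ι).toList.foldr (fun i g => (partialDeriv i)^[α i] g) φ

/-- `u` is a weak derivative `∂^α f` of `f` on the open set `Ω`. -/
structure IsWeakDeriv (Ω : Set (ι → ℝ)) (α : ι → ℕ) (f u : (ι → ℝ) → ℝ) : Prop where
  locallyIntegrable : LocallyIntegrableOn f Ω
  locallyIntegrable_deriv : LocallyIntegrableOn u Ω
  integral_eq : ∀ φ : (ι → ℝ) → ℝ, ContDiff ℝ ∞ φ → HasCompactSupport φ → tsupport φ ⊆ Ω →
    ∫ x in Ω, f x * multiDeriv α φ x = (-1) ^ (∑ i, α i) * ∫ x in Ω, u x * φ x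

/-- The Euclidean distance on `ι → ℝ`. -/
def euclDist (x y : ι → ℝ) : ℝ := Real.sqrt (∑ i, (x i - y i) ^ 2)

/-- The square of the Sobolev (Sobolev-Slobodeckij) norm of order `p` on `X`, in terms of the family
`D β` of weak derivatives: all derivatives of order at most `⌊p⌋` in `L²` and, if `p` is not an
integer, the fractional seminorm of exponent `p - ⌊p⌋` of the derivatives of order `⌊p⌋`. -/
def sobolevNormSq (X : Set (ι → ℝ)) (p : ℝ) (D : (ι → ℕ) → (ι → ℝ) → ℝ) : ℝ≥0∞ :=
  (∑ j ∈ Finset.range (⌊p⌋₊ + 1), ∑ β ∈ Finset.piAntidiag (Finset.univ : Finset ι) j,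
    ∫⁻ x in X, ENNReal.ofReal ((D β x) ^ 2)) +
  open Classical in
  if (⌊p⌋₊ : ℝ) = p then 0 else
    ∑ β ∈ Finset.piAntidiag (Finset.univ : Finset ι) ⌊p⌋₊, ∫⁻ x in X, ∫⁻ y in X,
      ENNReal.ofReal ((D β x - D β y) ^ 2 /
        euclDist x y ^ ((Fintype.card ι : ℝ) + 2 * (p - ⌊p⌋₊)))

/-- The Sobolev ball `Λ₂(p, L)` of smoothness `p` and radius `L` on `X` (Lebesgue measure). -/
def sobolevBall (X : Set (ι → ℝ)) (p L : ℝ) : Set ((ι → ℝ) → ℝ) :=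
  {g | ∃ D : (ι → ℕ) → (ι → ℝ) → ℝ,
    (∀ β, ∑ i, β i ≤ ⌊p⌋₊ → IsWeakDeriv (interior X) β g (D β)) ∧
    sobolevNormSq X p D ≤ ENNReal.ofReal (L ^ 2)}

/-- `‖∂^α f - ∂^α g‖₂`, the norm of `L²(X)` for Lebesgue measure. Weak derivatives are unique up to
null sets; the value is `∞` if `f` or `g` has no weak derivative `∂^α`. -/
def derivDist (X : Set (ι → ℝ)) (α : ι → ℕ) (f g : (ι → ℝ) → ℝ) : ℝ≥0∞ :=
  ⨅ (u : (ι → ℝ) → ℝ) (v : (ι → ℝ) → ℝ) (_ : IsWeakDeriv (interior X) α f u)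
    (_ : IsWeakDeriv (interior X) α g v), eLpNorm (u - v) 2 (volume.restrict X)

end Sobolev

/-! ### The Markov decision process -/

/-- States. -/
abbrev State (m : ℕ) : Type := Fin m → ℝ

/-- Actions. -/
abbrev Action (k : ℕ) : Type := Fin k → ℝ

/-- State-action pairs: `Sum.elim s a` is the pair `(s, a)`. -/
abbrev StateAction (m k : ℕ) : Type := Fin m ⊕ Fin k → ℝ

variable {m k : ℕ}

/-- The state of a state-action pair. -/
def stateOf (x : StateAction m k) : State m := fun i => x (Sum.inl i)

/-- The action of a state-action pair. -/
def actionOf (x : StateAction m k) : Action k := fun i => x (Sum.inr i)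

/-- The rectangle `𝒮 × 𝒜` with lower corner `lo` and upper corner `hi`. -/
def pairSpace (lo hi : StateAction m k) : Set (StateAction m k) := Set.Icc lo hi

/-- The state space `𝒮`. -/
def stateSpace (lo hi : StateAction m k) : Set (State m) := Set.Icc (stateOf lo) (stateOf hi)

/-- The action space `𝒜`. -/
def actionSpace (lo hi : StateAction m k) : Set (Action k) := Set.Icc (actionOf lo) (actionOf hi)

/-- `μ₀` is a probability density on the state space. -/
structure IsStateDensity (lo hi : StateAction m k) (μ₀ : State m → ℝ) : Prop where
  measurable : Measurable μ₀
  nonneg : ∀ s ∈ stateSpace lo hi, 0 ≤ μ₀ s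
  lintegral_eq_one : ∫⁻ s in stateSpace lo hi, ENNReal.ofReal (μ₀ s) = 1

/-- `π s a` is the density `π(a | s)` of a stationary policy. -/
structure IsPolicy (lo hi : StateAction m k) (π : State m → Action k → ℝ) : Prop where
  measurable : Measurable (Function.uncurry π)
  nonneg : ∀ s ∈ stateSpace lo hi, ∀ a ∈ actionSpace lo hi, 0 ≤ π s a
  lintegral_eq_one : ∀ s ∈ stateSpace lo hi,
    ∫⁻ a in actionSpace lo hi, ENNReal.ofReal (π s a) = 1

/-- `q x s'` is the transition density `q(s' | s, a)` at `x = (s, a)`. -/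
structure IsTransition (lo hi : StateAction m k) (q : StateAction m k → State m → ℝ) : Prop where
  measurable : Measurable (Function.uncurry q)
  nonneg : ∀ x ∈ pairSpace lo hi, ∀ s' ∈ stateSpace lo hi, 0 ≤ q x s'
  lintegral_eq_one : ∀ x ∈ pairSpace lo hi,
    ∫⁻ s' in stateSpace lo hi, ENNReal.ofReal (q x s') = 1

/-- The density of the state `S_t` when `S_0` has density `μ₀` and actions follow the policy `ν`. -/
def stateDensityAt (lo hi : StateAction m k) (μ₀ : State m → ℝ) (ν : State m → Action k → ℝ)
    (q : StateAction m k → State m → ℝ) : ℕ → State m → ℝ≥0∞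
  | 0 => fun s => ENNReal.ofReal (μ₀ s)
  | t + 1 => fun s' => ∫⁻ x in pairSpace lo hi,
      stateDensityAt lo hi μ₀ ν q t (stateOf x) * ENNReal.ofReal (ν (stateOf x) (actionOf x)) *
        ENNReal.ofReal (q x s')

/-- The average visitation density `(1/H) ∑_{t < H} q_t^ν(s, a)`, where `q_t^ν` is the density of
`(S_t, A_t)`. -/
def avgVisitation (lo hi : StateAction m k) (μ₀ : State m → ℝ) (ν : State m → Action k → ℝ)
    (q : StateAction m k → State m → ℝ) (H : ℕ) (x : StateAction m k) : ℝ≥0∞ :=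
  (H : ℝ≥0∞)⁻¹ * ∑ t ∈ Finset.range H,
    stateDensityAt lo hi μ₀ ν q t (stateOf x) * ENNReal.ofReal (ν (stateOf x) (actionOf x))

/-- For every state, the distribution `π(· | s)` is absolutely continuous with respect to
`ν(· | s)`. -/
def PolicyAbsCont (lo hi : StateAction m k) (π ν : State m → Action k → ℝ) : Prop :=
  ∀ s ∈ stateSpace lo hi,
    (volume.restrict (actionSpace lo hi)).withDensity (fun a => ENNReal.ofReal (π s a)) ≪
      (volume.restrict (actionSpace lo hi)).withDensity (fun a => ENNReal.ofReal (ν s a))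

/-! ### The model and the minimax risk -/

/-- Transition tuples `(S, A, R, S')`, written `((S, A), R, S')`. -/
abbrev Tuple (m k : ℕ) : Type := StateAction m k × ℝ × State m

/-- `h^π(s, a, s'; Q) = Q(s, a) - γ ∫ π(a' | s') Q(s', a') da'`. -/
def hFun (lo hi : StateAction m k) (π : State m → Action k → ℝ) (γ : ℝ)
    (Q : StateAction m k → ℝ) (x : StateAction m k) (s' : State m) : ℝ :=
  Q x - γ * ∫ a' in actionSpace lo hi, π s' a' * Q (Sum.elim s' a')

/-- The error `U = R - h^π(S, A, S'; Q)` of a tuple. -/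
def modelError (lo hi : StateAction m k) (π : State m → Action k → ℝ) (γ : ℝ)
    (Q : StateAction m k → ℝ) (z : Tuple m k) : ℝ :=
  z.2.1 - hFun lo hi π γ Q z.1 z.2.2

/-- The σ-algebra generated by `(S, A)`. -/
abbrev pairSigma (m k : ℕ) : MeasurableSpace (Tuple m k) :=
  MeasurableSpace.comap (fun z : Tuple m k => z.1) inferInstance

/-- `P` is a law of one transition tuple in the model `R = h^π(S, A, S'; Q) + U`: `(S, A)` has
density `d`, `S'` given `(S, A)` has density `q`, `E[U | S, A] = 0`, and
`E[U² | S, A] = v(S, A)`. -/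
structure IsModelLaw (lo hi : StateAction m k) (d : StateAction m k → ℝ≥0∞)
    (q : StateAction m k → State m → ℝ) (π : State m → Action k → ℝ) (γ : ℝ)
    (v : StateAction m k → ℝ) (Q : StateAction m k → ℝ) (P : Measure (Tuple m k)) : Prop where
  isProbabilityMeasure : IsProbabilityMeasure P
  map_eq : P.map (fun z => (z.1, z.2.2)) =
    ((volume.restrict (pairSpace lo hi)).prod (volume.restrict (stateSpace lo hi))).withDensity
      (fun w => d w.1 * ENNReal.ofReal (q w.1 w.2))
  integrable_error : Integrable (modelError lo hi π γ Q) P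
  condExp_error : P[modelError lo hi π γ Q | pairSigma m k] =ᵐ[P] 0
  integrable_sq : Integrable (fun z => modelError lo hi π γ Q z ^ 2) P
  condExp_sq : P[fun z => modelError lo hi π γ Q z ^ 2 | pairSigma m k] =ᵐ[P] fun z => v z.1

/-- The data: tuples indexed by `1 ≤ i ≤ N` and `0 ≤ t < T`. -/
abbrev Data (m k N T : ℕ) : Type := Fin N × Fin T → Tuple m k

/-- Estimators of a function on `𝒮 × 𝒜` from the data. -/
abbrev Estimator (m k N T : ℕ) : Type :=
  {Qhat : Data m k N T → StateAction m k → ℝ // Measurable (Function.uncurry Qhat)}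

/-- `inf_{Q̂} sup_{Q ∈ Λ₂(p, L)} Pr(‖∂^α Q̂ - ∂^α Q‖₂ ≥ r)` for i.i.d. data; the supremum is over `Q`
and over all laws of the model with this `Q`. -/
def minimaxProb (lo hi : StateAction m k) (d : StateAction m k → ℝ≥0∞)
    (q : StateAction m k → State m → ℝ) (π : State m → Action k → ℝ) (γ : ℝ)
    (v : StateAction m k → ℝ) (p L : ℝ) (α : Fin m ⊕ Fin k → ℕ) (N T : ℕ) (r : ℝ) : ℝ≥0∞ :=
  ⨅ Qhat : Estimator m k N T,
    ⨆ (Q : StateAction m k → ℝ) (_ : Q ∈ sobolevBall (pairSpace lo hi) p L)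
      (P : Measure (Tuple m k)) (_ : IsModelLaw lo hi d q π γ v Q P),
      Measure.pi (fun _ : Fin N × Fin T => P)
        {D | ENNReal.ofReal r ≤ derivDist (pairSpace lo hi) α (Qhat.1 D) Q}

end QMinimax

end

/-! The lower bound comes from Assouad's method on a hypercube of bump functions. A cube of edge `ℓ`
in the rectangle is cut into `M ^ d` cells, and `Q_θ = a ∑ θ_j ψ((M / ℓ)(x - c_j))` switches a bump
on or off in each cell. Since the supports are disjoint, the Sobolev norm is at most a multiple of
`a M ^ p`, whatever the number of bumps, while the squared `L²` distance of the derivatives `∂^α` is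
a multiple of `(a M ^ |α|) ^ 2 M ^ (-d)` times the Hamming distance. This is `exists_bump_family`.

Separation is measured on `Q` itself, so the map `Q ↦ h^π` never has to be inverted.
Indistinguishability needs only an upper bound on `h^π`: Jensen's inequality and the density bounds
give `E[h^π(·; Q)²] ≤ 2 (p₁ + p₂) ‖Q‖₂²` (`lintegral_hFun_sq_le`).

The law of the error may be chosen. The reward takes the values `-2√w, 0, 2√w` for every `Q`, where
`w = v` on the rectangle; only the probabilities depend on `Q`, through `t = h^π / √w`, and they are
tuned so that the conditional mean is `h^π` and the conditional variance is `w`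
(`isModelLaw_rewardLaw`). The support being common to all `Q`, the `χ²` divergence is at most `10
E[(t' - t)²]` (`sum_noiseWeight_sq_div_le`), hence of order `a ^ 2 M ^ (-d)` for adjacent vertices.

With `n = NT` observations, `half_le_pi_add_pi_compl` requires `n a ^ 2 M ^ (-d)` to be small, and
the Sobolev ball requires `a M ^ p` to be small. Taking `M ≈ n ^ (1 / (2p + d))` and `a = c₀ M ^
(-p)` meets both, and `assouad` then gives an error of order `a M ^ |α| ≈ n ^ ((|α| - p) / (2p +
d))` with probability at least `1/8`. -/

namespace QMinimax

set_option linter.unusedSectionVars false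

/-! ### Classical and weak partial derivatives -/

section Derivatives

variable {ι : Type} [Fintype ι] [DecidableEq ι]

lemma contDiff_partialDeriv (i : ι) {f : (ι → ℝ) → ℝ} (hf : ContDiff ℝ ∞ f) :
    ContDiff ℝ ∞ (partialDeriv i f) :=
  (hf.fderiv_right (m := ∞) (by simp)).clm_apply contDiff_const

lemma contDiff_iterate_partialDeriv (i : ι) (n : ℕ) {f : (ι → ℝ) → ℝ} (hf : ContDiff ℝ ∞ f) :
    ContDiff ℝ ∞ ((partialDeriv i)^[n] f) := by
  induction n generalizing f with
  | zero => exact hf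
  | succ n ih => exact ih (contDiff_partialDeriv i hf)

lemma tsupport_partialDeriv_subset (i : ι) (f : (ι → ℝ) → ℝ) :
    tsupport (partialDeriv i f) ⊆ tsupport f :=
  tsupport_fderiv_apply_subset ℝ _

lemma tsupport_iterate_partialDeriv_subset (i : ι) (n : ℕ) (f : (ι → ℝ) → ℝ) :
    tsupport ((partialDeriv i)^[n] f) ⊆ tsupport f := by
  induction n generalizing f with
  | zero => exact subset_rfl
  | succ n ih => exact (ih _).trans (tsupport_partialDeriv_subset i f)

lemma hasCompactSupport_of_tsupport_subset {f g : (ι → ℝ) → ℝ} (hf : HasCompactSupport f)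
    (h : tsupport g ⊆ tsupport f) : HasCompactSupport g :=
  hf.of_isClosed_subset (isClosed_tsupport g) h

/-- The partial derivatives prescribed by `β` along the list `l`, the head of `l` first. -/
noncomputable def derivAlong (l : List ι) (β : ι → ℕ) (f : (ι → ℝ) → ℝ) : (ι → ℝ) → ℝ :=
  l.foldl (fun g i => (partialDeriv i)^[β i] g) f

lemma contDiff_derivAlong (l : List ι) (β : ι → ℕ) {f : (ι → ℝ) → ℝ} (hf : ContDiff ℝ ∞ f) :
    ContDiff ℝ ∞ (derivAlong l β f) := by
  induction l generalizing f with
  | nil => exact hf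
  | cons i l ih => exact ih (contDiff_iterate_partialDeriv i (β i) hf)

lemma tsupport_derivAlong_subset (l : List ι) (β : ι → ℕ) (f : (ι → ℝ) → ℝ) :
    tsupport (derivAlong l β f) ⊆ tsupport f := by
  induction l generalizing f with
  | nil => exact subset_rfl
  | cons i l ih => exact (ih _).trans (tsupport_iterate_partialDeriv_subset i (β i) f)

lemma contDiff_foldr_partialDeriv (l : List ι) (β : ι → ℕ) {φ : (ι → ℝ) → ℝ}
    (hφ : ContDiff ℝ ∞ φ) :
    ContDiff ℝ ∞ (l.foldr (fun i g => (partialDeriv i)^[β i] g) φ) := by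
  induction l with
  | nil => exact hφ
  | cons i l ih => exact contDiff_iterate_partialDeriv i (β i) ih

lemma tsupport_foldr_partialDeriv_subset (l : List ι) (β : ι → ℕ) (φ : (ι → ℝ) → ℝ) :
    tsupport (l.foldr (fun i g => (partialDeriv i)^[β i] g) φ) ⊆ tsupport φ := by
  induction l with
  | nil => exact subset_rfl
  | cons i l ih => exact (tsupport_iterate_partialDeriv_subset i (β i) _).trans ih

lemma integral_mul_partialDeriv (i : ι) {f φ : (ι → ℝ) → ℝ} (hf : ContDiff ℝ ∞ f)
    (hφ : ContDiff ℝ ∞ φ) (hc : HasCompactSupport φ) :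
    ∫ x, f x * partialDeriv i φ x = -∫ x, partialDeriv i f x * φ x := by
  have hc' := hasCompactSupport_of_tsupport_subset hc (tsupport_partialDeriv_subset i φ)
  refine integral_mul_fderiv_eq_neg_fderiv_mul_of_integrable (v := Pi.single i 1) ?_ ?_ ?_ ?_ ?_
  · exact ((contDiff_partialDeriv i hf).continuous.mul hφ.continuous).integrable_of_hasCompactSupport
      hc.mul_left
  · exact (hf.continuous.mul (contDiff_partialDeriv i hφ).continuous).integrable_of_hasCompactSupport
      hc'.mul_left
  · exact (hf.continuous.mul hφ.continuous).integrable_of_hasCompactSupport hc.mul_left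
  · exact fun x _ => (hf.differentiable (by simp)).differentiableAt
  · exact fun x _ => (hφ.differentiable (by simp)).differentiableAt

lemma integral_mul_iterate_partialDeriv (i : ι) (n : ℕ) {f φ : (ι → ℝ) → ℝ}
    (hf : ContDiff ℝ ∞ f) (hφ : ContDiff ℝ ∞ φ) (hc : HasCompactSupport φ) :
    ∫ x, f x * (partialDeriv i)^[n] φ x = (-1) ^ n * ∫ x, (partialDeriv i)^[n] f x * φ x := by
  induction n generalizing φ with
  | zero => simp
  | succ n ih =>
    rw [Function.iterate_succ_apply, ih (contDiff_partialDeriv i hφ)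
      (hasCompactSupport_of_tsupport_subset hc (tsupport_partialDeriv_subset i φ)),
      integral_mul_partialDeriv i (contDiff_iterate_partialDeriv i n hf) hφ hc,
      Function.iterate_succ_apply']
    ring

/-- Integration by parts strips the outermost derivative of `φ` first and puts it innermost on `f`.
The order is therefore reversed, `foldr` becoming `foldl`, and symmetry of mixed derivatives is
never needed. -/
lemma integral_mul_foldr_partialDeriv (l : List ι) (β : ι → ℕ) {f φ : (ι → ℝ) → ℝ}
    (hf : ContDiff ℝ ∞ f) (hφ : ContDiff ℝ ∞ φ) (hc : HasCompactSupport φ) :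
    ∫ x, f x * l.foldr (fun i g => (partialDeriv i)^[β i] g) φ x =
      (-1) ^ (l.map β).sum * ∫ x, derivAlong l β f x * φ x := by
  induction l generalizing f with
  | nil => simp [derivAlong]
  | cons i l ih =>
    rw [List.foldr_cons, integral_mul_iterate_partialDeriv i (β i) hf
      (contDiff_foldr_partialDeriv l β hφ) (hasCompactSupport_of_tsupport_subset hc
        (tsupport_foldr_partialDeriv_subset l β φ)),
      ih (contDiff_iterate_partialDeriv i (β i) hf), List.map_cons, List.sum_cons, pow_add,
      mul_assoc]
    rfl

/-- The classical derivative `∂^β f`, the coordinates being differentiated in the order opposite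
to that of `multiDeriv`. -/
noncomputable def classicalDeriv (β : ι → ℕ) (f : (ι → ℝ) → ℝ) : (ι → ℝ) → ℝ :=
  derivAlong (Finset.univ : Finset ι).toList β f

lemma isWeakDeriv_classicalDeriv {Ω : Set (ι → ℝ)} (β : ι → ℕ)
    {f : (ι → ℝ) → ℝ} (hf : ContDiff ℝ ∞ f) : IsWeakDeriv Ω β f (classicalDeriv β f) where
  locallyIntegrable := hf.continuous.locallyIntegrable.locallyIntegrableOn Ω
  locallyIntegrable_deriv :=
    (contDiff_derivAlong _ β hf).continuous.locallyIntegrable.locallyIntegrableOn Ω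
  integral_eq := by
    intro φ hφ hc hs
    rw [setIntegral_eq_integral_of_forall_compl_eq_zero,
      setIntegral_eq_integral_of_forall_compl_eq_zero]
    · have := integral_mul_foldr_partialDeriv (Finset.univ : Finset ι).toList β hf hφ hc
      rw [Finset.sum_map_toList] at this
      exact this
    · intro x hx
      rw [image_eq_zero_of_notMem_tsupport (fun h => hx (hs h)), mul_zero]
    · intro x hx
      rw [image_eq_zero_of_notMem_tsupport (f := multiDeriv β φ)
        (fun h => hx (hs (tsupport_foldr_partialDeriv_subset _ β φ h))), mul_zero]

/-- The fundamental lemma of the calculus of variations, applied to `u - v`. It allows the arbitrary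
representatives in `derivDist` to be replaced by classical derivatives. -/
lemma IsWeakDeriv.ae_eq {Ω : Set (ι → ℝ)} (hΩ : IsOpen Ω) {β : ι → ℕ} {f u v : (ι → ℝ) → ℝ}
    (hu : IsWeakDeriv Ω β f u) (hv : IsWeakDeriv Ω β f v) : u =ᵐ[volume.restrict Ω] v := by
  have hint : ∀ (w : (ι → ℝ) → ℝ), LocallyIntegrableOn w Ω → ∀ φ : (ι → ℝ) → ℝ,
      ContDiff ℝ ∞ φ → HasCompactSupport φ → tsupport φ ⊆ Ω →
      Integrable (fun x => w x * φ x) := by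
    intro w hw φ hφ hc hs
    have h1 : IntegrableOn w (tsupport φ) := hw.integrableOn_compact_subset hs hc
    have h2 : IntegrableOn (fun x => w x * φ x) (tsupport φ) := by
      simpa [mul_comm] using h1.continuousOn_mul hφ.continuous.continuousOn hc
    refine (integrableOn_iff_integrable_of_support_subset fun x hx => ?_).1 h2
    exact subset_tsupport φ (fun h => hx (by simp [h]))
  have key : ∀ᵐ x ∂(volume : Measure (ι → ℝ)), x ∈ Ω → (u - v) x = 0 := by
    refine hΩ.ae_eq_zero_of_integral_contDiff_smul_eq_zero
      (hu.locallyIntegrable_deriv.sub hv.locallyIntegrable_deriv) ?_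
    intro φ hφ hc hs
    have e := (hu.integral_eq φ hφ hc hs).symm.trans (hv.integral_eq φ hφ hc hs)
    have e' := mul_left_cancel₀ (pow_ne_zero _ (by norm_num : (-1 : ℝ) ≠ 0)) e
    have z : ∀ w : (ι → ℝ) → ℝ, ∀ x ∉ Ω, w x * φ x = 0 := fun w x hx => by
      rw [image_eq_zero_of_notMem_tsupport (fun h => hx (hs h)), mul_zero]
    rw [setIntegral_eq_integral_of_forall_compl_eq_zero (z u),
      setIntegral_eq_integral_of_forall_compl_eq_zero (z v)] at e'
    have : ∀ x, φ x • (u - v) x = u x * φ x - v x * φ x := fun x => by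
      simp only [Pi.sub_apply, smul_eq_mul]; ring
    simp_rw [this]
    rw [integral_sub (hint u hu.locallyIntegrable_deriv φ hφ hc hs)
      (hint v hv.locallyIntegrable_deriv φ hφ hc hs), e', sub_self]
  rw [Filter.EventuallyEq, ae_restrict_iff' hΩ.measurableSet]
  filter_upwards [key] with x hx h
  simpa [sub_eq_zero] using hx h

/-- The function is constant on lines in direction `i`, and each such line leaves the compact
support. Iterated, this shows that `∂^α ψ` does not vanish identically for a nonzero bump `ψ`. -/
lemma eq_zero_of_partialDeriv_eq_zero (i : ι) {f : (ι → ℝ) → ℝ} (hf : ContDiff ℝ ∞ f)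
    (hc : HasCompactSupport f) (h : partialDeriv i f = 0) : f = 0 := by
  ext x
  obtain ⟨e, he⟩ : ∃ e : ι → ℝ, e = Pi.single i 1 := ⟨_, rfl⟩
  have hz : ∀ y, fderiv ℝ f y e = 0 := fun y => by rw [he]; exact congrFun h y
  have hd : ∀ t : ℝ, HasDerivAt (fun t : ℝ => f (x + t • e)) 0 t := by
    intro t
    have h1 : HasDerivAt (fun t : ℝ => x + t • e) e t := by
      simpa using ((hasDerivAt_id t).smul_const e).const_add x
    have h2 : HasFDerivAt f (fderiv ℝ f (x + t • e)) (x + t • e) :=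
      (hf.differentiable (by simp)).differentiableAt.hasFDerivAt
    rw [← hz (x + t • e)]
    exact h2.comp_hasDerivAt t h1
  have hconst : ∀ t : ℝ, f (x + t • e) = f x := by
    intro t
    have := is_const_of_deriv_eq_zero (f := fun t : ℝ => f (x + t • e))
      (fun t => (hd t).differentiableAt) (fun t => (hd t).deriv) t 0
    simpa using this
  obtain ⟨R, hR⟩ := hc.isCompact.isBounded.subset_closedBall (0 : ι → ℝ)
  -- After this shift the `i`-th coordinate is at least `|R| + 1`, outside the ball that contains
  -- the support.
  rw [← hconst (|R| + 1 + |x i|)]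
  refine image_eq_zero_of_notMem_tsupport (fun hmem => ?_)
  have h1 := hR hmem
  rw [mem_closedBall_zero_iff] at h1
  have h2 := (norm_le_pi_norm (x + (|R| + 1 + |x i|) • e) i).trans h1
  simp only [he, Pi.add_apply, Pi.smul_apply, Pi.single_eq_same, smul_eq_mul, mul_one,
    Real.norm_eq_abs] at h2
  have h3 := le_abs_self (x i + (|R| + 1 + |x i|))
  have h4 := neg_abs_le (x i)
  have h5 := le_abs_self R
  linarith

lemma eq_zero_of_derivAlong_eq_zero (l : List ι) (β : ι → ℕ) {f : (ι → ℝ) → ℝ}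
    (hf : ContDiff ℝ ∞ f) (hc : HasCompactSupport f) (h : derivAlong l β f = 0) : f = 0 := by
  have hit : ∀ (i : ι) (n : ℕ) {g : (ι → ℝ) → ℝ}, ContDiff ℝ ∞ g → HasCompactSupport g →
      (partialDeriv i)^[n] g = 0 → g = 0 := by
    intro i n
    induction n with
    | zero => exact fun _ _ h => h
    | succ n ih =>
      intro g hg hgc h
      exact eq_zero_of_partialDeriv_eq_zero i hg hgc (ih (contDiff_partialDeriv i hg)
        (hasCompactSupport_of_tsupport_subset hgc (tsupport_partialDeriv_subset i g)) h)
  induction l generalizing f with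
  | nil => exact h
  | cons i l ih =>
    exact hit i (β i) hf hc (ih (contDiff_iterate_partialDeriv i (β i) hf)
      (hasCompactSupport_of_tsupport_subset hc (tsupport_iterate_partialDeriv_subset i (β i) f)) h)

/-! ### Superpositions of scaled and translated bumps -/

variable {J : Type} [Fintype J]

/-- The function `a ∑ θ_j g(lam (x - c_j))`. -/
noncomputable def bumpSum (a lam : ℝ) (c : J → ι → ℝ) (θ : J → ℝ) (g : (ι → ℝ) → ℝ) : (ι → ℝ) → ℝ :=
  fun x => a * ∑ j, θ j * g (lam • (x - c j))

lemma contDiff_bumpSum (a lam : ℝ) (c : J → ι → ℝ) (θ : J → ℝ) {g : (ι → ℝ) → ℝ}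
    (hg : ContDiff ℝ ∞ g) : ContDiff ℝ ∞ (bumpSum a lam c θ g) := by
  unfold bumpSum
  refine contDiff_const.mul (ContDiff.sum fun j _ => contDiff_const.mul (hg.comp ?_))
  exact (contDiff_id.sub contDiff_const).const_smul lam

/-- By the chain rule bump sums are closed under differentiation, each derivative costing a factor
`lam` in the amplitude. Estimates for bump sums thus apply to their derivatives. -/
lemma partialDeriv_bumpSum (i : ι) (a lam : ℝ) (c : J → ι → ℝ) (θ : J → ℝ) {g : (ι → ℝ) → ℝ}
    (hg : ContDiff ℝ ∞ g) :
    partialDeriv i (bumpSum a lam c θ g) = bumpSum (a * lam) lam c θ (partialDeriv i g) := by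
  ext x
  have hj : ∀ j, HasFDerivAt (fun x => g (lam • (x - c j)))
      ((fderiv ℝ g (lam • (x - c j))).comp (lam • ContinuousLinearMap.id ℝ (ι → ℝ))) x := by
    intro j
    refine (hg.differentiable (by simp)).differentiableAt.hasFDerivAt.comp x ?_
    exact ((hasFDerivAt_id x).sub_const (c j)).const_smul lam
  have := (HasFDerivAt.fun_sum (u := Finset.univ) fun j _ => (hj j).const_mul (θ j)).const_mul a
  unfold partialDeriv bumpSum
  rw [this.fderiv]
  simp only [smul_apply, sum_apply,
    ContinuousLinearMap.comp_apply, ContinuousLinearMap.id_apply, map_smul, smul_eq_mul]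
  rw [mul_assoc]
  congr 1
  rw [Finset.mul_sum]
  refine Finset.sum_congr rfl fun j _ => ?_
  ring

lemma iterate_partialDeriv_bumpSum (i : ι) (n : ℕ) (a lam : ℝ) (c : J → ι → ℝ) (θ : J → ℝ)
    {g : (ι → ℝ) → ℝ} (hg : ContDiff ℝ ∞ g) :
    (partialDeriv i)^[n] (bumpSum a lam c θ g) =
      bumpSum (a * lam ^ n) lam c θ ((partialDeriv i)^[n] g) := by
  induction n generalizing a g with
  | zero => simp
  | succ n ih =>
    rw [Function.iterate_succ_apply, partialDeriv_bumpSum i a lam c θ hg,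
      ih _ (contDiff_partialDeriv i hg), Function.iterate_succ_apply, mul_assoc, pow_succ']

lemma derivAlong_bumpSum (l : List ι) (β : ι → ℕ) (a lam : ℝ) (c : J → ι → ℝ) (θ : J → ℝ)
    {g : (ι → ℝ) → ℝ} (hg : ContDiff ℝ ∞ g) :
    derivAlong l β (bumpSum a lam c θ g) =
      bumpSum (a * lam ^ (l.map β).sum) lam c θ (derivAlong l β g) := by
  induction l generalizing a g with
  | nil => simp [derivAlong]
  | cons i l ih =>
    unfold derivAlong at ih ⊢
    rw [List.foldl_cons, iterate_partialDeriv_bumpSum i (β i) a lam c θ hg,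
      ih _ (contDiff_iterate_partialDeriv i (β i) hg), List.foldl_cons, List.map_cons,
      List.sum_cons, pow_add, mul_assoc]

lemma classicalDeriv_bumpSum (β : ι → ℕ) (a lam : ℝ) (c : J → ι → ℝ) (θ : J → ℝ)
    {g : (ι → ℝ) → ℝ} (hg : ContDiff ℝ ∞ g) :
    classicalDeriv β (bumpSum a lam c θ g) =
      bumpSum (a * lam ^ ∑ i, β i) lam c θ (classicalDeriv β g) := by
  unfold classicalDeriv
  rw [derivAlong_bumpSum _ β a lam c θ hg, Finset.sum_map_toList]

end Derivatives

/-! ### Disjoint bumps: sup, Lipschitz, `L²` and fractional bounds -/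

section Bumps

variable {ι : Type} [Fintype ι] [DecidableEq ι] {J : Type} [Fintype J]

/-- The bumps `g(lam (x - c_j))` have disjoint supports. -/
structure SeparatedBumps (lam : ℝ) (c : J → ι → ℝ) (g : (ι → ℝ) → ℝ) : Prop where
  eq_zero : ∀ x, 1 / 2 ≤ ‖x‖ → g x = 0
  one_le_norm : ∀ j j', j ≠ j' → 1 ≤ ‖lam • (c j - c j')‖

namespace SeparatedBumps

variable {lam : ℝ} {c : J → ι → ℝ} {g : (ι → ℝ) → ℝ} (hs : SeparatedBumps lam c g)

include hs

lemma eq_of_ne_zero {x : ι → ℝ} {j j' : J} (hj : g (lam • (x - c j)) ≠ 0)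
    (hj' : g (lam • (x - c j')) ≠ 0) : j = j' := by
  by_contra hne
  have h1 : ‖lam • (x - c j)‖ < 1 / 2 := not_le.1 fun h => hj (hs.eq_zero _ h)
  have h2 : ‖lam • (x - c j')‖ < 1 / 2 := not_le.1 fun h => hj' (hs.eq_zero _ h)
  have h3 := hs.one_le_norm j j' hne
  have h4 : lam • (c j - c j') = lam • (x - c j') - lam • (x - c j) := by
    rw [← smul_sub]; congr 1; abel
  rw [h4] at h3
  have := norm_sub_le (lam • (x - c j')) (lam • (x - c j))
  linarith

lemma card_active_le_one (x : ι → ℝ) :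
    (Finset.univ.filter fun j => g (lam • (x - c j)) ≠ 0).card ≤ 1 := by
  refine Finset.card_le_one.2 fun j hj j' hj' => ?_
  exact hs.eq_of_ne_zero (Finset.mem_filter.1 hj).2 (Finset.mem_filter.1 hj').2

lemma abs_bumpSum_le {C : ℝ} (hC : ∀ x, |g x| ≤ C) (a : ℝ) {θ : J → ℝ} (hθ : ∀ j, |θ j| ≤ 1)
    (x : ι → ℝ) : |bumpSum a lam c θ g x| ≤ |a| * C := by
  have hC0 : 0 ≤ C := (abs_nonneg _).trans (hC 0)
  unfold bumpSum
  rw [abs_mul]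
  refine mul_le_mul_of_nonneg_left ?_ (abs_nonneg a)
  rw [← Finset.sum_filter_of_ne (p := fun j => g (lam • (x - c j)) ≠ 0)
    (fun j _ h => right_ne_zero_of_mul h)]
  refine (Finset.abs_sum_le_sum_abs _ _).trans ?_
  refine (Finset.sum_le_card_nsmul _ _ C fun j _ => ?_).trans ?_
  · rw [abs_mul]
    exact (mul_le_mul (hθ j) (hC _) (abs_nonneg _) zero_le_one).trans (one_mul C).le
  · rw [nsmul_eq_mul]
    have : ((Finset.univ.filter fun j => g (lam • (x - c j)) ≠ 0).card : ℝ) ≤ 1 := by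
      exact_mod_cast hs.card_active_le_one x
    nlinarith

/-- At most one bump is active at `x` and at most one at `y`, so at most two terms of the difference
survive; hence the factor 2, independent of the number of bumps. -/
lemma abs_bumpSum_sub_le {K : ℝ} (hK0 : 0 ≤ K) (hK : ∀ x y, |g x - g y| ≤ K * ‖x - y‖)
    (hlam : 0 ≤ lam) (a : ℝ) {θ : J → ℝ} (hθ : ∀ j, |θ j| ≤ 1) (x y : ι → ℝ) :
    |bumpSum a lam c θ g x - bumpSum a lam c θ g y| ≤ |a| * (2 * (K * (lam * ‖x - y‖))) := by
  classical
  unfold bumpSum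
  rw [← mul_sub, abs_mul, ← Finset.sum_sub_distrib]
  refine mul_le_mul_of_nonneg_left ?_ (abs_nonneg a)
  set A := fun x => Finset.univ.filter fun j => g (lam • (x - c j)) ≠ 0 with hA
  have hsub : ∑ j ∈ A x ∪ A y, (θ j * g (lam • (x - c j)) - θ j * g (lam • (y - c j))) =
      ∑ j, (θ j * g (lam • (x - c j)) - θ j * g (lam • (y - c j))) := by
    refine Finset.sum_subset (Finset.subset_univ _) fun j _ hj => ?_
    simp only [hA, Finset.mem_union, Finset.mem_filter, Finset.mem_univ, true_and, not_or,
      not_not] at hj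
    rw [hj.1, hj.2, sub_self]
  rw [← hsub]
  have hnn : 0 ≤ K * (lam * ‖x - y‖) := by positivity
  refine (Finset.abs_sum_le_sum_abs _ _).trans ?_
  refine (Finset.sum_le_card_nsmul _ _ (K * (lam * ‖x - y‖)) fun j _ => ?_).trans ?_
  · rw [← mul_sub, abs_mul]
    have h1 := hK (lam • (x - c j)) (lam • (y - c j))
    rw [← smul_sub, sub_sub_sub_cancel_right, norm_smul, Real.norm_eq_abs,
      abs_of_nonneg hlam] at h1
    exact (mul_le_mul (hθ j) h1 (abs_nonneg _) zero_le_one).trans (one_mul _).le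
  · rw [nsmul_eq_mul]
    refine mul_le_mul_of_nonneg_right ?_ hnn
    have h1 : (A x ∪ A y).card ≤ 2 := (Finset.card_union_le _ _).trans
      (add_le_add (hs.card_active_le_one x) (hs.card_active_le_one y))
    exact_mod_cast h1

/-- Cross terms vanish because the supports are disjoint. This orthogonality turns `L²` distances
into Hamming distances. -/
lemma bumpSum_sq (a : ℝ) (θ : J → ℝ) (x : ι → ℝ) :
    bumpSum a lam c θ g x ^ 2 = a ^ 2 * ∑ j, θ j ^ 2 * g (lam • (x - c j)) ^ 2 := by
  unfold bumpSum
  rw [mul_pow]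
  congr 1
  rw [sq, Finset.sum_mul_sum]
  refine Finset.sum_congr rfl fun j _ => ?_
  rw [Finset.sum_eq_single j]
  · ring
  · intro j' _ hne
    by_cases h : g (lam • (x - c j)) = 0
    · simp [h]
    · have : g (lam • (x - c j')) = 0 := by
        by_contra h'
        exact hne (hs.eq_of_ne_zero h' h)
      simp [this]
  · simp

lemma integral_bumpSum_sq (hg : Continuous g) (hc : HasCompactSupport g) (hlam : 0 < lam)
    (a : ℝ) (θ : J → ℝ) :
    Integrable (fun x => bumpSum a lam c θ g x ^ 2) ∧
    ∫ x, bumpSum a lam c θ g x ^ 2 =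
      a ^ 2 * (lam ^ Fintype.card ι)⁻¹ * (∑ j, θ j ^ 2) * ∫ x, g x ^ 2 := by
  have hsq : Integrable (fun x => g x ^ 2) := by
    have h : HasCompactSupport (fun x => g x * g x) := hc.mul_left
    simp_rw [sq]
    exact (hg.mul hg).integrable_of_hasCompactSupport h
  have hi : ∀ j, Integrable (fun x => g (lam • (x - c j)) ^ 2) := fun j =>
    ((hsq.comp_smul hlam.ne').comp_sub_right (c j))
  have hv : ∀ j, ∫ x, g (lam • (x - c j)) ^ 2 = (lam ^ Fintype.card ι)⁻¹ * ∫ x, g x ^ 2 := by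
    intro j
    rw [integral_sub_right_eq_self (fun x => g (lam • x) ^ 2) (c j),
      Measure.integral_comp_smul_of_nonneg volume (fun x => g x ^ 2) lam (hR := hlam.le)]
    simp
  simp_rw [hs.bumpSum_sq]
  refine ⟨(integrable_finsetSum _ fun j _ => (hi j).const_mul _).const_mul _, ?_⟩
  rw [integral_const_mul, integral_finsetSum _ fun j _ => (hi j).const_mul _]
  simp_rw [integral_const_mul, hv]
  rw [← Finset.sum_mul]
  ring

end SeparatedBumps

lemma norm_le_euclDist (x y : ι → ℝ) : ‖x - y‖ ≤ euclDist x y := by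
  refine (pi_norm_le_iff_of_nonneg (Real.sqrt_nonneg _)).2 fun i => ?_
  rw [Real.norm_eq_abs, Pi.sub_apply]
  exact Real.abs_le_sqrt (Finset.single_le_sum (f := fun i => (x i - y i) ^ 2)
    (fun i _ => sq_nonneg _) (Finset.mem_univ i))

/-- The integrand of the Slobodeckij seminorm of a bounded Lipschitz function. -/
noncomputable def slobodeckijKernel (ι : Type) [Fintype ι] (s : ℝ) (z : ι → ℝ) : ℝ :=
  min 1 (‖z‖ ^ 2) / ‖z‖ ^ ((Fintype.card ι : ℝ) + 2 * s)

lemma slobodeckijKernel_nonneg (s : ℝ) (z : ι → ℝ) : 0 ≤ slobodeckijKernel ι s z := by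
  unfold slobodeckijKernel; positivity

/-- In polar coordinates the radial integrand is `y ^ (1 - 2s)` near zero and `y ^ (-1 - 2s)` at
infinity: `s < 1` is used at the origin and `0 < s` at infinity. -/
lemma integrable_slobodeckijKernel [Nonempty ι] {s : ℝ} (hs0 : 0 < s) (hs1 : s < 1) :
    Integrable (slobodeckijKernel ι s) := by
  have hd : 1 ≤ Fintype.card ι := Fintype.card_pos
  set f : ℝ → ℝ := fun y => min 1 (y ^ 2) / y ^ ((Fintype.card ι : ℝ) + 2 * s) with hf
  suffices h : IntegrableOn (fun y : ℝ => y ^ (Module.finrank ℝ (ι → ℝ) - 1) • f y)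
      (Set.Ioi 0) from (integrable_fun_norm_addHaar (volume : Measure (ι → ℝ))).2 h
  have hpow : ∀ y : ℝ, 0 < y → y ^ (Module.finrank ℝ (ι → ℝ) - 1) • f y =
      min 1 (y ^ 2) * y ^ (-1 - 2 * s) := by
    intro y hy
    rw [hf, Module.finrank_fintype_fun_eq_card, smul_eq_mul, ← Real.rpow_natCast, mul_div_assoc',
      mul_comm, mul_div_assoc, ← Real.rpow_sub hy]
    congr 2
    push_cast [hd]
    ring
  rw [← Set.Ioc_union_Ioi_eq_Ioi (zero_le_one (α := ℝ))]
  refine IntegrableOn.union ?_ ?_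
  · have h1 : IntegrableOn (fun y : ℝ => y ^ (1 - 2 * s)) (Set.Ioc 0 1) :=
      (intervalIntegrable_iff_integrableOn_Ioc_of_le zero_le_one).1
        (intervalIntegral.intervalIntegrable_rpow' (by linarith))
    refine h1.congr_fun (fun y hy => ?_) measurableSet_Ioc
    simp only
    rw [hpow y hy.1, min_eq_right (pow_le_one₀ hy.1.le hy.2), ← Real.rpow_natCast,
      ← Real.rpow_add hy.1]
    congr 1
    push_cast
    ring
  · refine (integrableOn_Ioi_rpow_of_lt (a := -1 - 2 * s) (by linarith)
      zero_lt_one).congr_fun (fun y hy => ?_) measurableSet_Ioi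
    have hy1 : (1 : ℝ) < y := hy
    simp only
    rw [hpow y (by linarith), min_eq_left (one_le_pow₀ hy1.le), one_mul]

/-- Substitute `z = lam (x - y)` in the inner integral: the denominator yields `lam ^ (d + 2s)` and
the Jacobian `lam ^ (-d)`, leaving `lam ^ (2s)`, the cost of `s` derivatives. The bound is uniform
in `x`, so the outer integral only adds the volume. -/
lemma lintegral_slobodeckij_le [Nonempty ι] {X : Set (ι → ℝ)} {s : ℝ} (hs0 : 0 < s)
    (hs1 : s < 1) {G : (ι → ℝ) → ℝ} {A lam : ℝ} (hlam : 0 < lam)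
    (hG : ∀ x y, |G x - G y| ≤ A * min 1 (lam * ‖x - y‖)) :
    ∫⁻ x in X, ∫⁻ y in X, ENNReal.ofReal ((G x - G y) ^ 2 /
        euclDist x y ^ ((Fintype.card ι : ℝ) + 2 * s)) ≤
      volume X * ENNReal.ofReal (A ^ 2 * lam ^ (2 * s) * ∫ z, slobodeckijKernel ι s z) := by
  set d : ℝ := (Fintype.card ι : ℝ)
  have hd : 0 ≤ d := Nat.cast_nonneg _
  have hK := integrable_slobodeckijKernel (ι := ι) hs0 hs1
  have hpt : ∀ x y, (G x - G y) ^ 2 / euclDist x y ^ (d + 2 * s) ≤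
      A ^ 2 * lam ^ (d + 2 * s) * slobodeckijKernel ι s (lam • (x - y)) := by
    intro x y
    have hnum : (G x - G y) ^ 2 ≤ A ^ 2 * min 1 ((lam * ‖x - y‖) ^ 2) := by
      have h1 := hG x y
      have h2 : (G x - G y) ^ 2 ≤ (A * min 1 (lam * ‖x - y‖)) ^ 2 := by
        rw [← sq_abs (G x - G y)]
        exact pow_le_pow_left₀ (abs_nonneg _) h1 2
      rw [mul_pow] at h2
      refine h2.trans (mul_le_mul_of_nonneg_left (le_min ?_ ?_) (sq_nonneg A))
      · exact pow_le_one₀ (by positivity) (min_le_left _ _)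
      · exact pow_le_pow_left₀ (by positivity) (min_le_right _ _) 2
    rcases eq_or_ne x y with rfl | hne
    · simp only [sub_self]
      have := slobodeckijKernel_nonneg s (lam • (0 : ι → ℝ))
      rw [show (0 : ℝ) ^ 2 = 0 by norm_num, zero_div]
      positivity
    · have hpos : 0 < ‖x - y‖ := norm_pos_iff.2 (sub_ne_zero.2 hne)
      have hden : ‖x - y‖ ^ (d + 2 * s) ≤ euclDist x y ^ (d + 2 * s) :=
        Real.rpow_le_rpow hpos.le (norm_le_euclDist x y) (by positivity)
      refine (div_le_div₀ (by positivity) hnum (by positivity) hden).trans (le_of_eq ?_)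
      unfold slobodeckijKernel
      rw [norm_smul, Real.norm_eq_abs, abs_of_pos hlam, Real.mul_rpow hlam.le hpos.le]
      have : lam ^ (d + 2 * s) ≠ 0 := (Real.rpow_pos_of_pos hlam _).ne'
      have : ‖x - y‖ ^ (d + 2 * s) ≠ 0 := (Real.rpow_pos_of_pos hpos _).ne'
      change _ = A ^ 2 * lam ^ (d + 2 * s) * (_ / (lam ^ (d + 2 * s) * ‖x - y‖ ^ (d + 2 * s)))
      field_simp
  have hinner : ∀ x, ∫⁻ y in X, ENNReal.ofReal ((G x - G y) ^ 2 / euclDist x y ^ (d + 2 * s)) ≤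
      ENNReal.ofReal (A ^ 2 * lam ^ (2 * s) * ∫ z, slobodeckijKernel ι s z) := by
    intro x
    have hKx : Integrable (fun y => slobodeckijKernel ι s (lam • (x - y))) :=
      (hK.comp_smul hlam.ne').comp_sub_left x
    calc _ ≤ ∫⁻ y, ENNReal.ofReal
          (A ^ 2 * lam ^ (d + 2 * s) * slobodeckijKernel ι s (lam • (x - y))) :=
        (lintegral_mono fun y => ENNReal.ofReal_le_ofReal (hpt x y)).trans
          (setLIntegral_le_lintegral _ _)
      _ = ENNReal.ofReal (∫ y, A ^ 2 * lam ^ (d + 2 * s) *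
            slobodeckijKernel ι s (lam • (x - y))) := by
        rw [ofReal_integral_eq_lintegral_ofReal (hKx.const_mul _)]
        exact Eventually.of_forall fun y => mul_nonneg (by positivity)
          (slobodeckijKernel_nonneg s _)
      _ = _ := by
        rw [integral_const_mul,
          integral_sub_left_eq_self (fun y => slobodeckijKernel ι s (lam • y)) volume x,
          Measure.integral_comp_smul_of_nonneg volume _ lam (hR := hlam.le),
          Module.finrank_fintype_fun_eq_card, Real.rpow_add hlam, smul_eq_mul]
        congr 1
        rw [show lam ^ d = lam ^ Fintype.card ι from Real.rpow_natCast _ _]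
        field_simp
  calc _ ≤ ∫⁻ _ in X, ENNReal.ofReal
        (A ^ 2 * lam ^ (2 * s) * ∫ z, slobodeckijKernel ι s z) := lintegral_mono hinner
    _ = _ := by rw [setLIntegral_const, mul_comm]

end Bumps

/-! ### Sobolev norm of a bump sum -/

section SobolevBound

variable {ι : Type} [Fintype ι] [DecidableEq ι] {J : Type} [Fintype J]

lemma contDiff_classicalDeriv (β : ι → ℕ) {f : (ι → ℝ) → ℝ} (hf : ContDiff ℝ ∞ f) :
    ContDiff ℝ ∞ (classicalDeriv β f) := contDiff_derivAlong _ β hf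

lemma tsupport_classicalDeriv_subset (β : ι → ℕ) (f : (ι → ℝ) → ℝ) :
    tsupport (classicalDeriv β f) ⊆ tsupport f := tsupport_derivAlong_subset _ β f

lemma hasCompactSupport_classicalDeriv (β : ι → ℕ) {f : (ι → ℝ) → ℝ} (hc : HasCompactSupport f) :
    HasCompactSupport (classicalDeriv β f) :=
  hasCompactSupport_of_tsupport_subset hc (tsupport_classicalDeriv_subset β f)

lemma SeparatedBumps.classicalDeriv {lam : ℝ} {c : J → ι → ℝ} {g : (ι → ℝ) → ℝ}
    (hg : tsupport g ⊆ Metric.ball 0 (1 / 2))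
    (hsep : ∀ j j', j ≠ j' → 1 ≤ ‖lam • (c j - c j')‖) (β : ι → ℕ) :
    SeparatedBumps lam c (classicalDeriv β g) where
  eq_zero := fun x hx => by
    refine image_eq_zero_of_notMem_tsupport fun h => ?_
    have := hg (tsupport_classicalDeriv_subset β g h)
    rw [mem_ball_zero_iff] at this
    linarith
  one_le_norm := hsep

lemma setLIntegral_ofReal_sq_le {X : Set (ι → ℝ)} {G : (ι → ℝ) → ℝ} {B : ℝ}
    (hG : ∀ x, |G x| ≤ B) :
    ∫⁻ x in X, ENNReal.ofReal (G x ^ 2) ≤ volume X * ENNReal.ofReal (B ^ 2) := by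
  calc _ ≤ ∫⁻ _ in X, ENNReal.ofReal (B ^ 2) := by
        refine lintegral_mono fun x => ENNReal.ofReal_le_ofReal ?_
        rw [← sq_abs]
        exact pow_le_pow_left₀ (abs_nonneg _) (hG x) 2
    _ = _ := by rw [setLIntegral_const, mul_comm]

/-- The derivative `∂^β` has amplitude `a lam ^ |β|`, and `lam ^ |β| ≤ lam₀ ^ (|β| - p) lam ^ p` for
`|β| ≤ p` and `lam ≥ lam₀`. At the top order the fractional seminorm supplies the missing `lam ^ (p
- ⌊p⌋)`. Sup bounds times the volume suffice, and with disjoint supports they do not see how many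
bumps there are. -/
theorem exists_sobolevNormSq_bumpSum_le [Nonempty ι] {X : Set (ι → ℝ)} (hX : volume X ≠ ⊤)
    {p : ℝ} (hp : 0 < p) {g : (ι → ℝ) → ℝ} (hg : ContDiff ℝ ∞ g) (hc : HasCompactSupport g)
    (hsupp : tsupport g ⊆ Metric.ball 0 (1 / 2)) {lam₀ : ℝ} (hlam₀ : 0 < lam₀) :
    ∃ C : ℝ, 0 ≤ C ∧ ∀ (J : Type) [Fintype J] (a lam : ℝ) (c : J → ι → ℝ) (θ : J → ℝ),
      lam₀ ≤ lam → (∀ j j', j ≠ j' → 1 ≤ ‖lam • (c j - c j')‖) → (∀ j, |θ j| ≤ 1) →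
      sobolevNormSq X p (fun β => classicalDeriv β (bumpSum a lam c θ g)) ≤
        ENNReal.ofReal (C * (a * lam ^ p) ^ 2) := by
  classical
  have hsup : ∀ β : ι → ℕ, ∃ C : ℝ, ∀ x, |classicalDeriv β g x| ≤ C := fun β =>
    (contDiff_classicalDeriv β hg).continuous.bounded_above_of_compact_support
      (hasCompactSupport_classicalDeriv β hc)
  have hlip : ∀ β : ι → ℕ, ∃ K : ℝ, 0 ≤ K ∧
      ∀ x y, |classicalDeriv β g x - classicalDeriv β g y| ≤ K * ‖x - y‖ := fun β => by
    obtain ⟨K, hK⟩ := ContDiff.lipschitzWith_of_hasCompactSupport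
      (hasCompactSupport_classicalDeriv β hc) (contDiff_classicalDeriv β hg) (by simp)
    exact ⟨K, K.2, fun x y => by simpa [Real.dist_eq, dist_eq_norm] using hK.dist_le_mul x y⟩
  choose C hC using hsup
  choose K hK0 hK using hlip
  have hC0 : ∀ β, 0 ≤ C β := fun β => (abs_nonneg _).trans (hC β 0)
  set V : ℝ := (volume X).toReal with hV
  have hVX : volume X = ENNReal.ofReal V := (ENNReal.ofReal_toReal hX).symm
  have hV0 : 0 ≤ V := ENNReal.toReal_nonneg
  set n := ⌊p⌋₊ with hn
  have hnp : (n : ℝ) ≤ p := Nat.floor_le hp.le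
  set I : ℝ := ∫ z, slobodeckijKernel ι (p - n) z with hI
  have hI0 : 0 ≤ I := integral_nonneg fun z => slobodeckijKernel_nonneg _ z
  set c₁ : (ι → ℕ) → ℝ := fun β => V * (C β * lam₀ ^ (((∑ i, β i : ℕ) : ℝ) - p)) ^ 2 with hc₁
  -- The maximum covers both regimes of `min 1 (lam ‖x - y‖)`: `C β` bounds distant increments and
  -- `K β` close ones; the 2 counts the active bumps.
  set c₂ : (ι → ℕ) → ℝ := fun β => V * ((2 * max (C β) (K β)) ^ 2 * I) with hc₂
  have hc₁0 : ∀ β, 0 ≤ c₁ β := fun β => by positivity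
  have hc₂0 : ∀ β, 0 ≤ c₂ β := fun β => by positivity
  refine ⟨(∑ j ∈ Finset.range (n + 1), ∑ β ∈ Finset.piAntidiag (Finset.univ : Finset ι) j, c₁ β) +
    ∑ β ∈ Finset.piAntidiag (Finset.univ : Finset ι) n, c₂ β,
    add_nonneg (Finset.sum_nonneg fun j _ => Finset.sum_nonneg fun β _ => hc₁0 β)
      (Finset.sum_nonneg fun β _ => hc₂0 β), ?_⟩
  intro J _ a lam c θ hlam hsep hθ
  have hlam0 : 0 < lam := hlam₀.trans_le hlam
  have hbound₁ : ∀ β : ι → ℕ, ∑ i, β i ≤ n →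
      ∫⁻ x in X, ENNReal.ofReal (classicalDeriv β (bumpSum a lam c θ g) x ^ 2) ≤
        ENNReal.ofReal (c₁ β * (a * lam ^ p) ^ 2) := by
    intro β hβ
    have hS := SeparatedBumps.classicalDeriv hsupp hsep β
    rw [classicalDeriv_bumpSum β a lam c θ hg]
    have hβp : ((∑ i, β i : ℕ) : ℝ) - p ≤ 0 := by
      have : ((∑ i, β i : ℕ) : ℝ) ≤ n := by exact_mod_cast hβ
      linarith
    refine (setLIntegral_ofReal_sq_le (hS.abs_bumpSum_le (hC β) _ hθ)).trans ?_
    rw [hVX, ← ENNReal.ofReal_mul hV0]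
    refine ENNReal.ofReal_le_ofReal ?_
    rw [hc₁]
    simp only
    rw [mul_assoc, ← mul_pow]
    refine mul_le_mul_of_nonneg_left ?_ hV0
    rw [abs_mul, ← sq_abs (_ * (a * _)), abs_mul, abs_mul a, abs_of_nonneg (a := C β * _)
      (mul_nonneg (hC0 β) (by positivity)), abs_of_nonneg (a := lam ^ p) (by positivity),
      abs_of_nonneg (a := lam ^ (∑ i, β i)) (by positivity)]
    have h1 : lam ^ (∑ i, β i) ≤ lam₀ ^ (((∑ i, β i : ℕ) : ℝ) - p) * lam ^ p := by
      rw [← Real.rpow_natCast lam]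
      calc lam ^ ((∑ i, β i : ℕ) : ℝ) = lam ^ (((∑ i, β i : ℕ) : ℝ) - p) * lam ^ p := by
            rw [← Real.rpow_add hlam0]; congr 1; ring
        _ ≤ _ := mul_le_mul_of_nonneg_right (Real.rpow_le_rpow_of_nonpos hlam₀ hlam hβp)
            (by positivity)
    refine pow_le_pow_left₀ (by have := hC0 β; positivity) ?_ 2
    calc |a| * lam ^ (∑ i, β i) * C β
        ≤ |a| * (lam₀ ^ (((∑ i, β i : ℕ) : ℝ) - p) * lam ^ p) * C β := by
          refine mul_le_mul_of_nonneg_right ?_ (hC0 β)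
          exact mul_le_mul_of_nonneg_left h1 (abs_nonneg a)
      _ = _ := by ring
  have hbound₂ : (n : ℝ) ≠ p → ∀ β : ι → ℕ, ∑ i, β i = n →
      ∫⁻ x in X, ∫⁻ y in X, ENNReal.ofReal ((classicalDeriv β (bumpSum a lam c θ g) x -
        classicalDeriv β (bumpSum a lam c θ g) y) ^ 2 /
        euclDist x y ^ ((Fintype.card ι : ℝ) + 2 * (p - n))) ≤
        ENNReal.ofReal (c₂ β * (a * lam ^ p) ^ 2) := by
    intro hne β hβ
    have hS := SeparatedBumps.classicalDeriv hsupp hsep β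
    rw [classicalDeriv_bumpSum β a lam c θ hg, hβ]
    have hs0 : 0 < p - n := by
      rcases lt_or_eq_of_le hnp with h | h
      · linarith
      · exact absurd h hne
    have hs1 : p - n < 1 := by linarith [Nat.lt_floor_add_one p]
    have hmax : 0 ≤ max (C β) (K β) := (hC0 β).trans (le_max_left _ _)
    have hG : ∀ x y, |bumpSum (a * lam ^ n) lam c θ (classicalDeriv β g) x -
        bumpSum (a * lam ^ n) lam c θ (classicalDeriv β g) y| ≤
        |a * lam ^ n| * (2 * max (C β) (K β)) * min 1 (lam * ‖x - y‖) := by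
      intro x y
      have hnn : 0 ≤ |a * lam ^ n| * (2 * max (C β) (K β)) := by positivity
      rcases min_cases 1 (lam * ‖x - y‖) with ⟨h, _⟩ | ⟨h, _⟩ <;> rw [h]
      · have h1 := hS.abs_bumpSum_le (hC β) (a * lam ^ n) hθ x
        have h2 := hS.abs_bumpSum_le (hC β) (a * lam ^ n) hθ y
        refine (abs_sub _ _).trans ?_
        have h3 : |a * lam ^ n| * C β ≤ |a * lam ^ n| * max (C β) (K β) :=
          mul_le_mul_of_nonneg_left (le_max_left _ _) (abs_nonneg _)
        linarith
      · refine (hS.abs_bumpSum_sub_le (hK0 β) (hK β) hlam0.le (a * lam ^ n) hθ x y).trans ?_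
        have h3 : K β * (lam * ‖x - y‖) ≤ max (C β) (K β) * (lam * ‖x - y‖) :=
          mul_le_mul_of_nonneg_right (le_max_right _ _) (by positivity)
        have := mul_le_mul_of_nonneg_left h3 (abs_nonneg (a * lam ^ n))
        linarith
    refine (lintegral_slobodeckij_le hs0 hs1 hlam0 hG).trans ?_
    rw [hVX, ← ENNReal.ofReal_mul hV0]
    refine ENNReal.ofReal_le_ofReal (le_of_eq ?_)
    have h2 : lam ^ p = lam ^ n * lam ^ (p - n) := by
      rw [← Real.rpow_natCast lam n, ← Real.rpow_add hlam0]; congr 1; ring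
    have h3 : lam ^ (2 * (p - n)) = (lam ^ (p - n)) ^ 2 := by
      rw [← Real.rpow_natCast, ← Real.rpow_mul hlam0.le]; congr 1; push_cast; ring
    rw [h2, h3, mul_pow |a * lam ^ n|, sq_abs, hc₂]
    ring
  unfold sobolevNormSq
  rw [add_mul, ENNReal.ofReal_add (mul_nonneg (Finset.sum_nonneg fun j _ =>
      Finset.sum_nonneg fun β _ => hc₁0 β) (sq_nonneg _))
    (mul_nonneg (Finset.sum_nonneg fun β _ => hc₂0 β) (sq_nonneg _))]
  refine add_le_add ?_ ?_
  · rw [Finset.sum_mul, ENNReal.ofReal_sum_of_nonneg fun j _ =>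
      mul_nonneg (Finset.sum_nonneg fun β _ => hc₁0 β) (sq_nonneg _)]
    refine Finset.sum_le_sum fun j hj => ?_
    rw [Finset.sum_mul, ENNReal.ofReal_sum_of_nonneg fun β _ =>
      mul_nonneg (hc₁0 β) (sq_nonneg _)]
    refine Finset.sum_le_sum fun β hβ => hbound₁ β ?_
    rw [Finset.mem_piAntidiag] at hβ
    rw [hβ.1]
    exact Nat.lt_succ_iff.1 (Finset.mem_range.1 hj)
  · split_ifs with h
    · exact zero_le
    · rw [Finset.sum_mul, ENNReal.ofReal_sum_of_nonneg fun β _ =>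
        mul_nonneg (hc₂0 β) (sq_nonneg _)]
      refine Finset.sum_le_sum fun β hβ => hbound₂ h β ?_
      exact (Finset.mem_piAntidiag.1 hβ).1

end SobolevBound

/-! ### Separation of derivatives and the bump family on a grid -/

section Separation

variable {ι : Type} [Fintype ι] [DecidableEq ι]

lemma integral_sq_le_of_eLpNorm_le {Ω : Type*} [MeasurableSpace Ω] {μ : Measure Ω} {f : Ω → ℝ}
    (hf : Integrable (fun x => f x ^ 2) μ) {r : ℝ} (hr : 0 ≤ r)
    (h : eLpNorm f 2 μ ≤ ENNReal.ofReal r) : ∫ x, f x ^ 2 ∂μ ≤ r ^ 2 := by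
  have h1 : eLpNorm f 2 μ ^ 2 = ENNReal.ofReal (∫ x, f x ^ 2 ∂μ) := by
    rw [eLpNorm_eq_lintegral_rpow_enorm_toReal (by norm_num) (by norm_num), ← ENNReal.rpow_natCast,
      ← ENNReal.rpow_mul, ofReal_integral_eq_lintegral_ofReal hf
        (Eventually.of_forall fun x => sq_nonneg _)]
    simp only [ENNReal.toReal_ofNat, Nat.cast_ofNat, one_div, inv_mul_cancel₀ (two_ne_zero' ℝ),
      ENNReal.rpow_one]
    refine lintegral_congr fun x => ?_
    rw [← ofReal_norm, ENNReal.ofReal_rpow_of_nonneg (norm_nonneg _) zero_le_two,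
      Real.norm_eq_abs]
    congr 1
    rw [Real.rpow_two, sq_abs]
  have h2 := pow_le_pow_left' h 2
  rw [h1, ← ENNReal.ofReal_pow hr] at h2
  exact (ENNReal.ofReal_le_ofReal_iff (by positivity)).1 h2

/-- Triangle inequality through a weak derivative of `g`. The two infima may use different
representatives for `g`, but these agree almost everywhere by uniqueness. The hypothesis `hX` passes
from the interior, where derivatives are defined, to `X`, where the norm is taken. -/
lemma eLpNorm_sub_le_of_derivDist_lt {X : Set (ι → ℝ)}
    (hX : volume.restrict (interior X) = volume.restrict X) {α : ι → ℕ}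
    {g f₁ f₂ u₁ u₂ : (ι → ℝ) → ℝ} (h₁ : IsWeakDeriv (interior X) α f₁ u₁)
    (h₂ : IsWeakDeriv (interior X) α f₂ u₂) {r : ℝ} (hr : 0 ≤ r)
    (hd₁ : derivDist X α g f₁ < ENNReal.ofReal r) (hd₂ : derivDist X α g f₂ < ENNReal.ofReal r) :
    eLpNorm (u₁ - u₂) 2 (volume.restrict X) ≤ ENNReal.ofReal (2 * r) := by
  unfold derivDist at hd₁ hd₂
  simp only [iInf_lt_iff] at hd₁ hd₂
  obtain ⟨w₁, v₁, hw₁, hv₁, hn₁⟩ := hd₁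
  obtain ⟨w₂, v₂, hw₂, hv₂, hn₂⟩ := hd₂
  have e₁ := hv₁.ae_eq isOpen_interior h₁
  have e₂ := hv₂.ae_eq isOpen_interior h₂
  have e₃ := hw₁.ae_eq isOpen_interior hw₂
  have meas : ∀ {f w : (ι → ℝ) → ℝ}, IsWeakDeriv (interior X) α f w →
      AEStronglyMeasurable w (volume.restrict X) := fun h => by
    rw [← hX]
    exact h.locallyIntegrable_deriv.aestronglyMeasurable
  rw [hX] at e₁ e₂ e₃
  have e : u₁ - u₂ =ᵐ[volume.restrict X] (w₂ - v₂) - (w₁ - v₁) := by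
    filter_upwards [e₁, e₂, e₃] with x h1 h2 h3
    simp only [Pi.sub_apply]
    rw [← h1, ← h2, ← h3]
    ring
  rw [eLpNorm_congr_ae e]
  refine (eLpNorm_sub_le ((meas hw₂).sub (meas hv₂)) ((meas hw₁).sub (meas hv₁))
    (by norm_num)).trans ?_
  rw [two_mul, ENNReal.ofReal_add hr hr]
  exact add_le_add hn₂.le hn₁.le

lemma restrict_interior_Icc (lo hi : ι → ℝ) :
    (volume : Measure (ι → ℝ)).restrict (interior (Set.Icc lo hi)) =
      volume.restrict (Set.Icc lo hi) :=
  Measure.restrict_congr_set (interior_ae_eq_of_null_frontier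
    ((convex_Icc lo hi).addHaar_frontier volume))

/-- The real vector of a vertex of the cube. -/
def signVector {J : Type} (θ : J → Bool) : J → ℝ := fun j => if θ j then 1 else 0

lemma abs_signVector_le {J : Type} (θ : J → Bool) (j : J) : |signVector θ j| ≤ 1 := by
  unfold signVector; split_ifs <;> simp

lemma sum_signVector_sub_sq {J : Type} [Fintype J] (θ θ' : J → Bool) :
    ∑ j, (signVector θ j - signVector θ' j) ^ 2 = hammingDist θ θ' := by
  classical
  rw [hammingDist, Finset.card_filter]
  push_cast
  refine Finset.sum_congr rfl fun j _ => ?_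
  unfold signVector
  cases θ j <;> cases θ' j <;> simp

lemma bumpSum_sub {J : Type} [Fintype J] (a lam : ℝ) (c : J → ι → ℝ) (θ θ' : J → ℝ)
    (g : (ι → ℝ) → ℝ) (x : ι → ℝ) :
    bumpSum a lam c θ g x - bumpSum a lam c θ' g x = bumpSum a lam c (θ - θ') g x := by
  unfold bumpSum
  rw [← mul_sub, ← Finset.sum_sub_distrib]
  simp [sub_mul]

/-- The centre of the cell `j` of the grid of `M ^ d` cells with edges `ℓ / M` and corner `lo`. -/
noncomputable def gridCenter (lo : ι → ℝ) (ℓ : ℝ) (M : ℕ) (j : ι → Fin M) : ι → ℝ :=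
  fun i => lo i + ℓ * (((j i : ℕ) : ℝ) + 1 / 2) / M

/-- After rescaling, two centres differ by a nonzero integer vector, whose sup norm is at least 1.
-/
lemma one_le_norm_gridCenter_sub (lo : ι → ℝ) {ℓ : ℝ} (hℓ : 0 < ℓ) {M : ℕ} (hM : 1 ≤ M)
    (j j' : ι → Fin M) (hne : j ≠ j') :
    1 ≤ ‖((M : ℝ) / ℓ) • (gridCenter lo ℓ M j - gridCenter lo ℓ M j')‖ := by
  obtain ⟨i, hi⟩ := Function.ne_iff.1 hne
  refine le_trans ?_ (norm_le_pi_norm _ i)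
  have hM0 : (0 : ℝ) < M := by exact_mod_cast hM
  have h : (((M : ℝ) / ℓ) • (gridCenter lo ℓ M j - gridCenter lo ℓ M j')) i =
      (((j i : ℕ) : ℤ) - ((j' i : ℕ) : ℤ) : ℤ) := by
    simp only [gridCenter, Pi.smul_apply, Pi.sub_apply, smul_eq_mul]
    push_cast
    field_simp
    ring
  rw [h, Real.norm_eq_abs, ← Int.cast_abs]
  have : ((j i : ℕ) : ℤ) - ((j' i : ℕ) : ℤ) ≠ 0 := by
    have := Fin.val_ne_of_ne hi
    omega
  exact_mod_cast Int.one_le_abs this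

lemma mem_Icc_of_norm_sub_gridCenter_lt {lo hi : ι → ℝ} {ℓ : ℝ} (hℓ : 0 < ℓ)
    (hlh : ∀ i, lo i + ℓ ≤ hi i) {M : ℕ} (hM : 1 ≤ M) (j : ι → Fin M) {x : ι → ℝ}
    (hx : ‖((M : ℝ) / ℓ) • (x - gridCenter lo ℓ M j)‖ < 1 / 2) : x ∈ Set.Icc lo hi := by
  have hM0 : (0 : ℝ) < M := by exact_mod_cast hM
  have key : ∀ i, |x i - gridCenter lo ℓ M j i| < ℓ / (2 * M) := by
    intro i
    have h := (norm_le_pi_norm _ i).trans_lt hx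
    rw [Pi.smul_apply, Pi.sub_apply, smul_eq_mul, norm_mul, Real.norm_eq_abs, Real.norm_eq_abs,
      abs_of_pos (by positivity), div_mul_eq_mul_div, div_lt_iff₀ hℓ] at h
    rw [lt_div_iff₀ (by positivity)]
    linarith
  have hj : ∀ i, ((j i : ℕ) : ℝ) + 1 ≤ M := fun i => by exact_mod_cast (j i).2
  have hcell : ∀ i, gridCenter lo ℓ M j i = lo i + ℓ * (j i : ℕ) / M + ℓ / (2 * M) := fun i => by
    unfold gridCenter; field_simp; ring
  refine ⟨fun i => ?_, fun i => ?_⟩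
  · have h1 := (abs_lt.1 (key i)).1
    rw [hcell] at h1
    have : 0 ≤ ℓ * ((j i : ℕ) : ℝ) / M := by positivity
    linarith
  · have h1 := (abs_lt.1 (key i)).2
    rw [hcell] at h1
    have h2 : ℓ * ((j i : ℕ) : ℝ) / M + ℓ / (2 * M) + ℓ / (2 * M) ≤ ℓ := by
      have : ℓ * ((j i : ℕ) : ℝ) / M + ℓ / (2 * M) + ℓ / (2 * M) =
        ℓ * (((j i : ℕ) : ℝ) + 1) / M := by field_simp; ring
      rw [this, div_le_iff₀ hM0]
      exact mul_le_mul_of_nonneg_left (hj i) hℓ.le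
    linarith [hlh i]

/-- Every bump lives in its own cell inside the rectangle, so nothing is lost by restricting the
integral; each contributes `(ℓ / M) ^ d ∫ g²`. -/
lemma setIntegral_bumpSum_sq {lo hi : ι → ℝ} {ℓ : ℝ} (hℓ : 0 < ℓ)
    (hlh : ∀ i, lo i + ℓ ≤ hi i) {M : ℕ} (hM : 1 ≤ M) {g : (ι → ℝ) → ℝ}
    (hg : Continuous g) (hc : HasCompactSupport g) (hz : ∀ x, 1 / 2 ≤ ‖x‖ → g x = 0)
    (a : ℝ) (θ : (ι → Fin M) → ℝ) :
    IntegrableOn (fun x => bumpSum a (M / ℓ) (gridCenter lo ℓ M) θ g x ^ 2) (Set.Icc lo hi) ∧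
    ∫ x in Set.Icc lo hi, bumpSum a (M / ℓ) (gridCenter lo ℓ M) θ g x ^ 2 =
      a ^ 2 * (ℓ ^ Fintype.card ι * ((M : ℝ) ^ Fintype.card ι)⁻¹) * (∑ j, θ j ^ 2) *
        ∫ x, g x ^ 2 := by
  have hM0 : (0 : ℝ) < M := by exact_mod_cast hM
  have hS : SeparatedBumps ((M : ℝ) / ℓ) (gridCenter lo ℓ M) g :=
    ⟨hz, one_le_norm_gridCenter_sub lo hℓ hM⟩
  obtain ⟨h1, h2⟩ := hS.integral_bumpSum_sq hg hc (by positivity) a θ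
  refine ⟨h1.integrableOn, ?_⟩
  rw [setIntegral_eq_integral_of_forall_compl_eq_zero, h2]
  · rw [div_pow, inv_div]
    ring
  · intro x hx
    rw [hS.bumpSum_sq, Finset.sum_eq_zero, mul_zero]
    intro j _
    rw [hz, zero_pow two_ne_zero, mul_zero]
    by_contra h
    exact hx (mem_Icc_of_norm_sub_gridCenter_lt hℓ hlh hM j (not_le.1 h))

/-- The essential point is that `C` and `κ` are fixed before `M` and `a`. The separation constant
`κ` is positive because `∂^α ψ` is a nonzero continuous function. -/
theorem exists_bump_family [Nonempty ι] {lo hi : ι → ℝ} (hlohi : ∀ i, lo i < hi i) {p : ℝ}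
    (hp : 0 < p) (α : ι → ℕ) :
    ∃ C > 0, ∃ κ > 0, ∀ M : ℕ, 1 ≤ M → ∀ a : ℝ, 0 ≤ a →
      ∃ f : ((ι → Fin M) → Bool) → (ι → ℝ) → ℝ,
        (∀ θ, Continuous (f θ)) ∧ (∀ θ x, |f θ x| ≤ C * a) ∧
        (∀ θ θ', ∫⁻ x in Set.Icc lo hi, ENNReal.ofReal ((f θ x - f θ' x) ^ 2) ≤
          ENNReal.ofReal (C * a ^ 2 * ((M : ℝ) ^ Fintype.card ι)⁻¹ * hammingDist θ θ')) ∧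
        (∀ θ L, C * (a * (M : ℝ) ^ p) ≤ L → f θ ∈ sobolevBall (Set.Icc lo hi) p L) ∧
        (∀ θ θ' g r, 0 ≤ r → derivDist (Set.Icc lo hi) α g (f θ) < ENNReal.ofReal r →
          derivDist (Set.Icc lo hi) α g (f θ') < ENNReal.ofReal r →
          κ * (a * (M : ℝ) ^ (∑ i, α i)) ^ 2 * ((M : ℝ) ^ Fintype.card ι)⁻¹ * hammingDist θ θ' ≤
            r ^ 2) := by
  -- With `ℓ` the shortest edge, a cube at the corner `lo` fits in the rectangle and carries all the
  -- bumps.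
  obtain ⟨ℓ, hℓ, hlh⟩ : ∃ ℓ > 0, ∀ i, lo i + ℓ ≤ hi i := by
    obtain ⟨i₀, hi₀⟩ := Finite.exists_min fun i => hi i - lo i
    exact ⟨hi i₀ - lo i₀, sub_pos.2 (hlohi i₀), fun i => by linarith [hi₀ i]⟩
  obtain ⟨ψ, hψs, hψc, hψ, hψr, hψ1⟩ := exists_contDiff_tsupport_subset (n := ⊤)
    (Metric.ball_mem_nhds (0 : ι → ℝ) (by norm_num : (0 : ℝ) < 1 / 2))
  have hψabs : ∀ x, |ψ x| ≤ 1 := fun x => by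
    have := hψr (Set.mem_range_self x)
    rw [abs_of_nonneg this.1]
    exact this.2
  have hψ0 : ψ ≠ 0 := fun h => by simp [h] at hψ1
  obtain ⟨C₀, hC₀, hsob⟩ := exists_sobolevNormSq_bumpSum_le (X := Set.Icc lo hi)
    isCompact_Icc.measure_lt_top.ne hp hψ hψc hψs (lam₀ := 1 / ℓ) (by positivity)
  set D := classicalDeriv α ψ with hD
  have hDc : Continuous D := (contDiff_classicalDeriv α hψ).continuous
  have hDs : HasCompactSupport D := hasCompactSupport_classicalDeriv α hψc
  have hDpos : 0 < ∫ x, D x ^ 2 := by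
    have hcs : HasCompactSupport (fun x => D x * D x) := hDs.mul_left
    have hne : ∃ x, D x ≠ 0 := by
      by_contra! h
      exact hψ0 (eq_zero_of_derivAlong_eq_zero _ α hψ hψc (funext h))
    obtain ⟨x, hx⟩ := hne
    simp_rw [sq]
    exact (hDc.mul hDc).integral_pos_of_hasCompactSupport_nonneg_nonzero hcs
      (fun x => mul_self_nonneg _) (x := x) (by simpa using hx)
  have hψnn : 0 ≤ ∫ x, ψ x ^ 2 := integral_nonneg fun x => sq_nonneg _
  set d := Fintype.card ι with hd
  set C : ℝ := 1 + ℓ ^ d * ∫ x, ψ x ^ 2 with hC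
  set B : ℝ := Real.sqrt C₀ * (1 / ℓ) ^ p with hB
  have hB0 : 0 ≤ B := by positivity
  have hCB : 0 ≤ ℓ ^ d * ∫ x, ψ x ^ 2 := by positivity
  -- `C` serves the sup and `L²` bounds and `B` the Sobolev norm; the `ℓ` factors come from the
  -- scale `M / ℓ`. The division by 4 absorbs the `(2 r) ^ 2` of the triangle inequality.
  refine ⟨C + B, by positivity, (ℓ ^ d * (∫ x, D x ^ 2) * ((1 / ℓ) ^ (∑ i, α i)) ^ 2) / 4,
    by positivity, ?_⟩
  intro M hM a ha
  have hM0 : (0 : ℝ) < M := by exact_mod_cast hM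
  have hsep := one_le_norm_gridCenter_sub lo hℓ hM
  have hS : SeparatedBumps ((M : ℝ) / ℓ) (gridCenter lo ℓ M) ψ := ⟨fun x hx => by
    refine image_eq_zero_of_notMem_tsupport fun h => ?_
    have := hψs h
    rw [mem_ball_zero_iff] at this
    linarith, hsep⟩
  have hSD : SeparatedBumps ((M : ℝ) / ℓ) (gridCenter lo ℓ M) D :=
    SeparatedBumps.classicalDeriv hψs hsep α
  have hsm : ∀ θ : (ι → Fin M) → ℝ,
      ContDiff ℝ ∞ (bumpSum a (M / ℓ) (gridCenter lo ℓ M) θ ψ) :=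
    fun θ => contDiff_bumpSum a _ _ θ hψ
  refine ⟨fun θ => bumpSum a (M / ℓ) (gridCenter lo ℓ M) (signVector θ) ψ,
    fun θ => (hsm _).continuous, fun θ x => ?_, fun θ θ' => ?_, fun θ L hL => ?_,
    fun θ θ' g r hr h₁ h₂ => ?_⟩
  · refine (hS.abs_bumpSum_le hψabs a (abs_signVector_le θ) x).trans ?_
    rw [abs_of_nonneg ha]
    nlinarith
  · simp_rw [bumpSum_sub]
    obtain ⟨hi1, hi2⟩ := setIntegral_bumpSum_sq hℓ hlh hM hψ.continuous hψc hS.eq_zero a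
      (signVector θ - signVector θ')
    rw [← ofReal_integral_eq_lintegral_ofReal hi1 (Eventually.of_forall fun x => sq_nonneg _), hi2]
    refine ENNReal.ofReal_le_ofReal ?_
    simp_rw [Pi.sub_apply]
    rw [sum_signVector_sub_sq]
    have : 0 ≤ a ^ 2 * ((M : ℝ) ^ d)⁻¹ * hammingDist θ θ' := by positivity
    nlinarith
  · refine ⟨fun β => classicalDeriv β _, fun β _ => isWeakDeriv_classicalDeriv β (hsm _), ?_⟩
    refine (hsob _ a _ _ _ ?_ hsep (abs_signVector_le θ)).trans (ENNReal.ofReal_le_ofReal ?_)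
    · gcongr
      exact_mod_cast hM
    · have h1 : ((M : ℝ) / ℓ) ^ p = (1 / ℓ) ^ p * (M : ℝ) ^ p := by
        rw [← Real.mul_rpow (by positivity) hM0.le]; congr 1; ring
      have h2 : C₀ * (a * ((M : ℝ) / ℓ) ^ p) ^ 2 = (B * (a * (M : ℝ) ^ p)) ^ 2 := by
        rw [h1, hB, mul_pow, mul_pow, mul_pow, mul_pow, mul_pow, Real.sq_sqrt hC₀]
        ring
      rw [h2]
      have h3 : 0 ≤ a * (M : ℝ) ^ p := by positivity
      refine pow_le_pow_left₀ (by positivity) (le_trans ?_ hL) 2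
      exact mul_le_mul_of_nonneg_right (by linarith) h3
  · have h := eLpNorm_sub_le_of_derivDist_lt (restrict_interior_Icc lo hi)
      (isWeakDeriv_classicalDeriv α (hsm _)) (isWeakDeriv_classicalDeriv α (hsm _)) hr h₁ h₂
    rw [classicalDeriv_bumpSum α _ _ _ _ hψ, classicalDeriv_bumpSum α _ _ _ _ hψ] at h
    have e : bumpSum (a * ((M : ℝ) / ℓ) ^ ∑ i, α i) (M / ℓ) (gridCenter lo ℓ M) (signVector θ) D -
        bumpSum (a * ((M : ℝ) / ℓ) ^ ∑ i, α i) (M / ℓ) (gridCenter lo ℓ M) (signVector θ') D =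
        bumpSum (a * ((M : ℝ) / ℓ) ^ ∑ i, α i) (M / ℓ) (gridCenter lo ℓ M)
          (signVector θ - signVector θ') D := funext fun x => bumpSum_sub _ _ _ _ _ _ x
    rw [e] at h
    obtain ⟨hi1, hi2⟩ := setIntegral_bumpSum_sq hℓ hlh hM hDc hDs hSD.eq_zero
      (a * ((M : ℝ) / ℓ) ^ ∑ i, α i) (signVector θ - signVector θ')
    have h3 := integral_sq_le_of_eLpNorm_le hi1 (by positivity) h
    rw [hi2] at h3
    simp_rw [Pi.sub_apply] at h3
    rw [sum_signVector_sub_sq, mul_pow, div_pow] at h3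
    rw [mul_pow, one_div, inv_pow]
    have h4 : (2 * r) ^ 2 = 4 * r ^ 2 := by ring
    rw [h4] at h3
    refine le_of_mul_le_mul_left (le_trans (le_of_eq ?_) h3) (by norm_num : (0 : ℝ) < 4)
    rw [hd]
    field_simp

end Separation

/-! ### Testing two product measures with small `χ²` divergence -/

section ProductTesting

variable {Ω : Type*} [MeasurableSpace Ω] {I : Type*} [Fintype I]

lemma lintegral_pi_prod (P : Measure Ω) [IsProbabilityMeasure P] (f : I → Ω → ℝ≥0∞)
    (hf : ∀ i, Measurable (f i)) :
    ∫⁻ x, ∏ i, f i (x i) ∂(Measure.pi fun _ : I => P) = ∏ i, ∫⁻ x, f i x ∂P := by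
  refine (ProbabilityTheory.lintegral_prod_eq_prod_lintegral_of_indepFun Finset.univ
    (fun i (x : I → Ω) => f i (x i))
    (ProbabilityTheory.iIndepFun_pi fun i => (hf i).aemeasurable)
    fun i => (hf i).comp (measurable_pi_apply i)).trans ?_
  refine Finset.prod_congr rfl fun i _ => ?_
  exact (measurePreserving_eval (fun _ : I => P) i).lintegral_comp (hf i)

lemma pi_withDensity (P : Measure Ω) [IsProbabilityMeasure P] {f : Ω → ℝ≥0∞} (hf : Measurable f)
    [IsProbabilityMeasure (P.withDensity f)] :
    Measure.pi (fun _ : I => P.withDensity f) =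
      (Measure.pi fun _ : I => P).withDensity fun x => ∏ i, f (x i) := by
  refine Measure.pi_eq fun s hs => ?_
  rw [withDensity_apply _ (MeasurableSet.univ_pi hs),
    ← lintegral_indicator (MeasurableSet.univ_pi hs)]
  have : ∀ x : I → Ω, (Set.univ.pi s).indicator (fun x => ∏ i, f (x i)) x =
      ∏ i, (s i).indicator f (x i) := by
    intro x
    by_cases h : x ∈ Set.univ.pi s
    · rw [Set.indicator_of_mem h]
      exact Finset.prod_congr rfl fun i _ => (Set.indicator_of_mem (h i (Set.mem_univ i)) f).symm
    · rw [Set.indicator_of_notMem h]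
      simp only [Set.mem_univ_pi, not_forall] at h
      obtain ⟨i, hi⟩ := h
      exact (Finset.prod_eq_zero (Finset.mem_univ i) (Set.indicator_of_notMem hi f)).symm
  simp_rw [this]
  rw [lintegral_pi_prod P _ fun i => hf.indicator (hs i)]
  refine Finset.prod_congr rfl fun i _ => ?_
  rw [lintegral_indicator (hs i), withDensity_apply _ (hs i)]

lemma half_le_of_sq_le {x y : ℝ} (h : y ^ 2 ≤ 2 * x) : 1 / 2 ≤ x + (1 - y) := by
  nlinarith [sq_nonneg (y - 1)]

/-- With `Q = F P`, Cauchy–Schwarz on `∫_A F dP` gives `Q(A)² ≤ 2 P(A)`, so `P(A) + 1 - Q(A) ≥ Q(A)²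
/ 2 + 1 - Q(A) = 1/2 + (Q(A) - 1)² / 2`. -/
lemma half_le_measure_add_compl (P : Measure Ω) [IsProbabilityMeasure P] {F : Ω → ℝ≥0∞}
    (hF : Measurable F) [IsProbabilityMeasure (P.withDensity F)]
    (h2 : ∫⁻ x, F x ^ 2 ∂P ≤ 2) {A : Set Ω} (hA : MeasurableSet A) :
    1 / 2 ≤ P A + P.withDensity F Aᶜ := by
  have hCS : P.withDensity F A ^ 2 ≤ 2 * P A := by
    have h := ENNReal.lintegral_mul_le_Lp_mul_Lq P Real.HolderConjugate.two_two
      hF.aemeasurable ((measurable_const (a := (1 : ℝ≥0∞))).indicator hA).aemeasurable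
    have e1 : ∫⁻ x, (F * A.indicator (fun _ => (1 : ℝ≥0∞))) x ∂P = P.withDensity F A := by
      rw [withDensity_apply _ hA, ← lintegral_indicator hA]
      refine lintegral_congr fun x => ?_
      by_cases hx : x ∈ A <;> simp [hx]
    have e2 : ∫⁻ x, (A.indicator (fun _ => (1 : ℝ≥0∞)) x) ^ (2 : ℝ) ∂P = P A := by
      rw [← lintegral_indicator_one hA]
      refine lintegral_congr fun x => ?_
      by_cases hx : x ∈ A <;> simp [hx]
    rw [e1, e2] at h
    simp only [ENNReal.rpow_two] at h
    have h' := pow_le_pow_left' h 2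
    rw [mul_pow, ← ENNReal.rpow_two, ← ENNReal.rpow_two, ← ENNReal.rpow_two, ← ENNReal.rpow_mul,
      ← ENNReal.rpow_mul] at h'
    norm_num at h'
    exact h'.trans (mul_le_mul_left h2 _)
  have hr : (P.withDensity F).real A ^ 2 ≤ 2 * P.real A := by
    have := ENNReal.toReal_mono (ENNReal.mul_ne_top (by norm_num) (measure_ne_top P A)) hCS
    simpa [Measure.real, ENNReal.toReal_mul, ENNReal.toReal_pow] using this
  have h3 := half_le_of_sq_le hr
  rw [← probReal_compl_eq_one_sub hA] at h3
  have h4 := ENNReal.ofReal_le_ofReal h3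
  rw [ENNReal.ofReal_add (by positivity) (by positivity), ofReal_measureReal,
    ofReal_measureReal] at h4
  refine le_trans (le_of_eq ?_) h4
  rw [ENNReal.ofReal_div_of_pos (by norm_num)]
  simp

lemma one_add_pow_le_two {δ : ℝ} (hδ : 0 ≤ δ) {n : ℕ} (h : n * δ ≤ 1 / 2) : (1 + δ) ^ n ≤ 2 := by
  have h1 : (1 + δ) ^ n ≤ Real.exp (n * δ) := by
    rw [Real.exp_nat_mul]
    exact pow_le_pow_left₀ (by positivity) (by linarith [Real.add_one_le_exp δ]) n
  have h2 : Real.exp (n * δ) ≤ Real.exp (1 / 2) := Real.exp_le_exp.2 h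
  have h3 : Real.exp (1 / 2) ^ 2 ≤ 2 ^ 2 := by
    rw [← Real.exp_nat_mul]
    norm_num
    linarith [Real.exp_one_lt_three]
  exact h1.trans (h2.trans ((pow_le_pow_iff_left₀ (Real.exp_pos _).le zero_le_two two_ne_zero).1 h3))

/-- Two hypotheses whose `χ²` divergence is at most `1 / (2 n)` cannot be told apart from `n`
observations. -/
theorem half_le_pi_add_pi_compl {Ω' : Type*} [MeasurableSpace Ω'] {μ : Measure Ω'}
    {g g' : Ω' → ℝ} (hg : Measurable g) (hg' : Measurable g') (hpos : ∀ x, 0 < g x)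
    (hnn : ∀ x, 0 ≤ g' x)
    [IsProbabilityMeasure (μ.withDensity fun x => ENNReal.ofReal (g x))]
    [IsProbabilityMeasure (μ.withDensity fun x => ENNReal.ofReal (g' x))]
    {T : Ω' → Ω} (hT : Measurable T) {δ : ℝ} (hδ : 0 ≤ δ)
    (hχ : ∫⁻ x, ENNReal.ofReal (g' x ^ 2 / g x) ∂μ ≤ ENNReal.ofReal (1 + δ))
    (hn : Fintype.card I * δ ≤ 1 / 2) {A : Set (I → Ω)} (hA : MeasurableSet A) :
    1 / 2 ≤ Measure.pi (fun _ : I => (μ.withDensity fun x => ENNReal.ofReal (g x)).map T) A +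
      Measure.pi (fun _ : I => (μ.withDensity fun x => ENNReal.ofReal (g' x)).map T) Aᶜ := by
  set P := μ.withDensity fun x => ENNReal.ofReal (g x) with hP
  set Q := μ.withDensity fun x => ENNReal.ofReal (g' x) with hQ
  have hf : Measurable fun x => ENNReal.ofReal (g' x / g x) := (hg'.div hg).ennreal_ofReal
  have hQP : Q = P.withDensity fun x => ENNReal.ofReal (g' x / g x) := by
    rw [hP, hQ, ← withDensity_mul _ hg.ennreal_ofReal hf]
    congr 1
    ext x
    rw [Pi.mul_apply, ← ENNReal.ofReal_mul (hpos x).le, mul_div_cancel₀ _ (hpos x).ne']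
  have : IsProbabilityMeasure (P.map T) := Measure.isProbabilityMeasure_map hT.aemeasurable
  have : IsProbabilityMeasure (Q.map T) := Measure.isProbabilityMeasure_map hT.aemeasurable
  have hTpi : Measurable fun (x : I → Ω') i => T (x i) :=
    measurable_pi_lambda _ fun i => hT.comp (measurable_pi_apply i)
  -- A test on the images under `T` is a test on the original points, so densities are only needed
  -- before applying `T`.
  rw [← Measure.pi_map_pi (fun _ => hT.aemeasurable), ← Measure.pi_map_pi (fun _ => hT.aemeasurable),
    Measure.map_apply hTpi hA, Measure.map_apply hTpi hA.compl, Set.preimage_compl]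
  have hQprob : IsProbabilityMeasure (P.withDensity fun x => ENNReal.ofReal (g' x / g x)) := by
    rw [← hQP]; infer_instance
  have hpi := pi_withDensity (I := I) P hf
  rw [← hQP] at hpi
  have : IsProbabilityMeasure ((Measure.pi fun _ : I => P).withDensity
      fun x => ∏ i, ENNReal.ofReal (g' (x i) / g (x i))) := by
    rw [← hpi]; infer_instance
  rw [hpi]
  have hFm : Measurable fun x : I → Ω' => ∏ i, ENNReal.ofReal (g' (x i) / g (x i)) :=
    Finset.measurable_prod _ fun i _ => hf.comp (measurable_pi_apply i)
  refine half_le_measure_add_compl _ hFm ?_ (hTpi hA)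
  -- The second moment of the likelihood ratio, `1 + χ²`, is multiplicative over independent
  -- observations.
  simp_rw [← Finset.prod_pow]
  rw [lintegral_pi_prod P (fun _ x => ENNReal.ofReal (g' x / g x) ^ 2) fun _ => hf.pow_const 2,
    Finset.prod_const, Finset.card_univ]
  have h1 : ∫⁻ x, ENNReal.ofReal (g' x / g x) ^ 2 ∂P ≤ ENNReal.ofReal (1 + δ) := by
    refine le_trans (le_of_eq ?_) hχ
    rw [hP, lintegral_withDensity_eq_lintegral_mul _ hg.ennreal_ofReal (hf.pow_const 2)]
    refine lintegral_congr fun x => ?_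
    rw [Pi.mul_apply, ← ENNReal.ofReal_pow (div_nonneg (hnn x) (hpos x).le),
      ← ENNReal.ofReal_mul (hpos x).le]
    congr 1
    have := (hpos x).ne'
    field_simp
  refine (pow_le_pow_left' h1 _).trans ?_
  rw [← ENNReal.ofReal_pow (by positivity)]
  refine (ENNReal.ofReal_le_ofReal (one_add_pow_le_two hδ hn)).trans (by simp)

end ProductTesting

/-! ### Assouad's lemma -/

section Assouad

variable {J : Type} [Fintype J] [DecidableEq J] {Ω : Type*} [MeasurableSpace Ω]

/-- The vertex of the cube adjacent to `θ` in the direction `j`. -/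
def flipAt (j : J) (θ : J → Bool) : J → Bool := Function.update θ j (!θ j)

@[simp] lemma flipAt_flipAt (j : J) (θ : J → Bool) : flipAt j (flipAt j θ) = θ := by
  unfold flipAt; simp

lemma flipAt_apply_self (j : J) (θ : J → Bool) : flipAt j θ j = !θ j := by
  unfold flipAt; simp

lemma hammingDist_flipAt (j : J) (θ : J → Bool) : hammingDist θ (flipAt j θ) = 1 := by
  rw [hammingDist, Finset.card_eq_one]
  refine ⟨j, ?_⟩
  ext i
  unfold flipAt
  by_cases h : i = j
  · subst h; simp
  · simp [h]

/-- Such an event depends on `z` only through a finite membership pattern, so it is a finite union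
of cells of the partition generated by the `B θ`. This covers decoders defined by arbitrary choice.
-/
lemma measurableSet_pred_of_family {K : Type*} [Finite K] {B : K → Set Ω}
    (hB : ∀ θ, MeasurableSet (B θ)) (q : Set K → Prop) :
    MeasurableSet {z | q {θ | z ∉ B θ}} := by
  have : {z | q {θ | z ∉ B θ}} = ⋃ S ∈ {S : Set K | q S}, {z | {θ | z ∉ B θ} = S} := by
    ext z; simp
  rw [this]
  refine MeasurableSet.biUnion (Set.to_countable _) fun S _ => ?_
  have : {z | {θ | z ∉ B θ} = S} = ⋂ θ, {z | z ∉ B θ ↔ θ ∈ S} := by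
    ext z; simp [Set.ext_iff]
  rw [this]
  refine MeasurableSet.iInter fun θ => ?_
  by_cases h : θ ∈ S
  · have e : {z | z ∉ B θ ↔ θ ∈ S} = (B θ)ᶜ := by ext z; simp [h]
    rw [e]; exact (hB θ).compl
  · have e : {z | z ∉ B θ ↔ θ ∈ S} = B θ := by ext z; simp [h]
    rw [e]; exact hB θ

/-- **Assouad's lemma** in probability: `B θ` is the event that the loss at `θ` is large, and no
observation has small loss at two vertices that are far apart. -/
theorem assouad [Nonempty J] (P : (J → Bool) → Measure Ω) [∀ θ, IsProbabilityMeasure (P θ)]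
    (htest : ∀ θ j A, MeasurableSet A → 1 / 2 ≤ P θ A + P (flipAt j θ) Aᶜ)
    (B : (J → Bool) → Set Ω)
    (hB : ∀ z θ θ', z ∉ B θ → z ∉ B θ' → 8 * hammingDist θ θ' ≤ Fintype.card J) :
    ∃ θ, 1 / 8 ≤ P θ (B θ) := by
  classical
  by_contra! hcon
  -- Loss events need not be measurable. Their hulls have the same `P θ` measure, and enlarging `B
  -- θ` only weakens the premises of `hB`.
  set B' : (J → Bool) → Set Ω := fun θ => toMeasurable (P θ) (B θ) with hB'
  have hB'm : ∀ θ, MeasurableSet (B' θ) := fun θ => measurableSet_toMeasurable _ _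
  -- The decoder returns any vertex with small loss. Its default value is irrelevant, since it
  -- occurs only when `z` lies in every `B' θ`.
  let pick : Set (J → Bool) → (J → Bool) := fun S =>
    if h : S.Nonempty then h.some else fun _ => false
  let est : Ω → J → Bool := fun z => pick {θ | z ∉ B' θ}
  have hest : ∀ z θ, z ∉ B' θ → 8 * hammingDist (est z) θ ≤ Fintype.card J := by
    intro z θ hz
    have hne : {θ | z ∉ B' θ}.Nonempty := ⟨θ, hz⟩
    have h1 : est z = hne.some := dif_pos hne
    have h2 : z ∉ B' (est z) := h1 ▸ hne.some_mem
    exact hB z _ _ (fun h => h2 (subset_toMeasurable _ _ h))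
      (fun h => hz (subset_toMeasurable _ _ h))
  set E : (J → Bool) → J → Set Ω := fun θ j => {z | est z j ≠ θ j} with hE
  have hEm : ∀ θ j, MeasurableSet (E θ j) := fun θ j =>
    measurableSet_pred_of_family hB'm fun S => pick S j ≠ θ j
  have hEflip : ∀ θ j, E (flipAt j θ) j = (E θ j)ᶜ := by
    intro θ j
    ext z
    simp only [hE, Set.mem_ofPred_eq, Set.mem_compl_iff, flipAt_apply_self, not_not]
    cases est z j <;> cases θ j <;> simp
  set K : ℝ := (Fintype.card J : ℝ) with hK
  have hK0 : 0 < K := by simpa [hK] using Fintype.card_pos (α := J)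
  -- The decoder makes at most `K / 8` coordinate errors off `B' θ` and at most `K` on it, an event
  -- of probability below `1/8`: fewer than `K / 4` on average.
  have hupper : ∀ θ, 8 * ∑ j, (P θ).real (E θ j) < 2 * K := by
    intro θ
    have hpt : ∀ z, 8 * ∑ j, (E θ j).indicator (fun _ => (1 : ℝ)) z ≤
        K + (B' θ).indicator (fun _ => 8 * K) z := by
      intro z
      have hham : ∑ j, (E θ j).indicator (fun _ => (1 : ℝ)) z = hammingDist (est z) θ := by
        rw [hammingDist, Finset.card_filter]
        push_cast
        refine Finset.sum_congr rfl fun j _ => ?_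
        simp [Set.indicator_apply, hE]
      rw [hham]
      by_cases h : z ∈ B' θ
      · rw [Set.indicator_of_mem h]
        have : (hammingDist (est z) θ : ℝ) ≤ K := by
          rw [hK]; exact_mod_cast hammingDist_le_card_fintype
        linarith
      · rw [Set.indicator_of_notMem h, add_zero, hK]
        exact_mod_cast hest z θ h
    have hi : ∀ j, Integrable ((E θ j).indicator fun _ => (1 : ℝ)) (P θ) := fun j =>
      (integrable_const _).indicator (hEm θ j)
    have h1 := integral_mono ((integrable_finsetSum Finset.univ fun j _ => hi j).const_mul 8)
      ((integrable_const K).add ((integrable_const (8 * K)).indicator (hB'm θ))) hpt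
    rw [integral_const_mul, integral_finsetSum _ fun j _ => hi j, integral_add' (integrable_const K)
      ((integrable_const (8 * K)).indicator (hB'm θ)), integral_indicator_const _ (hB'm θ)] at h1
    simp_rw [integral_indicator_const _ (hEm θ _)] at h1
    simp only [smul_eq_mul, mul_one, integral_const, probReal_univ, one_mul] at h1
    refine h1.trans_lt ?_
    have h2 : (P θ).real (B' θ) < 1 / 8 := by
      have h3 := hcon θ
      rw [← measure_toMeasurable] at h3
      have := (ENNReal.toReal_lt_toReal (measure_ne_top _ _) (by norm_num)).2 h3
      simpa [Measure.real, hB'] using this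
    nlinarith
  -- Flipping `j` permutes the vertices and exchanges the two kinds of error, so the testing bound
  -- `1/2` for a pair becomes `1/4` for each vertex on average.
  have hlower : ∀ j, (Fintype.card (J → Bool) : ℝ) / 4 ≤ ∑ θ, (P θ).real (E θ j) := by
    intro j
    have hinv : ∑ θ, (P (flipAt j θ)).real (E (flipAt j θ) j) = ∑ θ, (P θ).real (E θ j) :=
      Equiv.sum_comp (Function.Involutive.toPerm (flipAt j) (flipAt_flipAt j))
        fun θ => (P θ).real (E θ j)
    have hpair : ∀ θ, (1 : ℝ) / 2 ≤ (P θ).real (E θ j) +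
        (P (flipAt j θ)).real (E (flipAt j θ) j) := by
      intro θ
      have h := htest θ j (E θ j) (hEm θ j)
      rw [← hEflip] at h
      have := ENNReal.toReal_mono (ENNReal.add_ne_top.2 ⟨measure_ne_top _ _, measure_ne_top _ _⟩) h
      rw [ENNReal.toReal_add (measure_ne_top _ _) (measure_ne_top _ _)] at this
      simpa [Measure.real] using this
    have h := Finset.sum_le_sum fun θ (_ : θ ∈ Finset.univ) => hpair θ
    rw [Finset.sum_add_distrib, hinv, Finset.sum_const, Finset.card_univ, nsmul_eq_mul] at h
    linarith
  have h1 : ∑ θ : J → Bool, 8 * ∑ j, (P θ).real (E θ j) <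
      ∑ _θ : J → Bool, 2 * K := Finset.sum_lt_sum_of_nonempty Finset.univ_nonempty
    fun θ _ => hupper θ
  have h2 : ∑ _j : J, (Fintype.card (J → Bool) : ℝ) / 4 ≤ ∑ j, ∑ θ, (P θ).real (E θ j) :=
    Finset.sum_le_sum fun j _ => hlower j
  rw [← Finset.mul_sum, Finset.sum_comm, Finset.sum_const, Finset.card_univ, nsmul_eq_mul] at h1
  rw [Finset.sum_const, Finset.card_univ, nsmul_eq_mul, ← hK] at h2
  linarith

end Assouad

/-! ### The three-point noise -/

section Noise

/-- The possible values `-1, 0, 1` of the standardised reward. -/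
def noiseValue (e : Fin 3) : ℝ := ![-1, 0, 1] e

/-- The probabilities of the values `-1, 0, 1`; the variable with these values, multiplied by `2`,
has mean `t` and variance `1`. -/
noncomputable def noiseWeight (e : Fin 3) (t : ℝ) : ℝ :=
  ![(1 - t) ^ 2 / 8, (3 - t ^ 2) / 4, (1 + t) ^ 2 / 8] e

lemma noiseWeight_pos (e : Fin 3) {t : ℝ} (ht : |t| ≤ 1 / 2) : 0 < noiseWeight e t := by
  obtain ⟨h1, h2⟩ := abs_le.1 ht
  fin_cases e <;> simp only [noiseWeight, Fin.zero_eta, Fin.mk_one, Fin.reduceFinMk,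
    Matrix.cons_val] <;> nlinarith

lemma measurable_noiseWeight (e : Fin 3) : Measurable (noiseWeight e) := by
  unfold noiseWeight
  fin_cases e <;> simp only [Fin.zero_eta, Fin.mk_one, Fin.reduceFinMk, Matrix.cons_val] <;>
    fun_prop

lemma sum_noiseWeight (t : ℝ) : ∑ e, noiseWeight e t = 1 := by
  simp only [Fin.sum_univ_three, noiseWeight, Matrix.cons_val]
  ring

lemma sum_noiseWeight_mul_error (t r : ℝ) :
    ∑ e, noiseWeight e t * (2 * r * noiseValue e - t * r) = 0 := by
  simp only [Fin.sum_univ_three, noiseWeight, noiseValue, Matrix.cons_val]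
  ring

lemma sum_noiseWeight_mul_error_sq (t r : ℝ) :
    ∑ e, noiseWeight e t * (2 * r * noiseValue e - t * r) ^ 2 = r ^ 2 := by
  simp only [Fin.sum_univ_three, noiseWeight, noiseValue, Matrix.cons_val]
  ring

lemma abs_noiseValue_le (e : Fin 3) : |noiseValue e| ≤ 1 := by
  fin_cases e <;> simp [noiseValue]

/-- For weights `p, p'` one has `p'² / p = 2p' - p + (p' - p)² / p`, and `2p' - p` sums to 1. Each
weight is quadratic in `t` and bounded below for `|t| ≤ 1/2`, so the remainder is `O((t' - t)²)`;
the crude constants are `9/2 + 1 + 9/2 = 10`. -/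
lemma sum_noiseWeight_sq_div_le {t t' : ℝ} (ht : |t| ≤ 1 / 2) (ht' : |t'| ≤ 1 / 2) :
    ∑ e, noiseWeight e t' ^ 2 / noiseWeight e t ≤ 1 + 10 * (t' - t) ^ 2 := by
  obtain ⟨h1, h2⟩ := abs_le.1 ht
  obtain ⟨h1', h2'⟩ := abs_le.1 ht'
  have key : ∀ e : Fin 3, noiseWeight e t' ^ 2 / noiseWeight e t ≤
      2 * noiseWeight e t' - noiseWeight e t + ![9 / 2, 1, 9 / 2] e * (t' - t) ^ 2 := by
    intro e
    have hpos := noiseWeight_pos e ht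
    rw [div_le_iff₀ hpos]
    suffices h : (noiseWeight e t' - noiseWeight e t) ^ 2 ≤
        ![9 / 2, 1, 9 / 2] e * (t' - t) ^ 2 * noiseWeight e t by nlinarith
    fin_cases e <;> simp only [noiseWeight, Fin.zero_eta, Fin.mk_one, Fin.reduceFinMk,
      Matrix.cons_val]
    · have e1 : ((1 - t') ^ 2 / 8 - (1 - t) ^ 2 / 8) ^ 2 = (t' - t) ^ 2 * ((2 - t - t') ^ 2 / 64) := by
        ring
      have e2 : 9 / 2 * (t' - t) ^ 2 * ((1 - t) ^ 2 / 8) =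
        (t' - t) ^ 2 * (9 / 2 * ((1 - t) ^ 2 / 8)) := by ring
      rw [e1, e2]
      exact mul_le_mul_of_nonneg_left (by nlinarith) (sq_nonneg _)
    · have e1 : ((3 - t' ^ 2) / 4 - (3 - t ^ 2) / 4) ^ 2 = (t' - t) ^ 2 * ((t + t') ^ 2 / 16) := by
        ring
      have e2 : 1 * (t' - t) ^ 2 * ((3 - t ^ 2) / 4) = (t' - t) ^ 2 * ((3 - t ^ 2) / 4) := by ring
      rw [e1, e2]
      exact mul_le_mul_of_nonneg_left (by nlinarith) (sq_nonneg _)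
    · have e1 : ((1 + t') ^ 2 / 8 - (1 + t) ^ 2 / 8) ^ 2 = (t' - t) ^ 2 * ((2 + t + t') ^ 2 / 64) := by
        ring
      have e2 : 9 / 2 * (t' - t) ^ 2 * ((1 + t) ^ 2 / 8) =
        (t' - t) ^ 2 * (9 / 2 * ((1 + t) ^ 2 / 8)) := by ring
      rw [e1, e2]
      exact mul_le_mul_of_nonneg_left (by nlinarith) (sq_nonneg _)
  refine (Finset.sum_le_sum fun e _ => key e).trans (le_of_eq ?_)
  rw [Finset.sum_add_distrib, Finset.sum_sub_distrib, ← Finset.mul_sum, sum_noiseWeight,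
    sum_noiseWeight]
  simp only [Fin.sum_univ_three, Matrix.cons_val]
  ring

variable {Ω : Type*} [MeasurableSpace Ω]

/-- The law of `(z, e)` when `z` has law `ρ` and, given `z`, the index `e` has probability
`noiseWeight e (t z)`. -/
noncomputable def noiseLaw (ρ : Measure Ω) (t : Ω → ℝ) : Measure (Ω × Fin 3) :=
  (ρ.prod Measure.count).withDensity fun z => ENNReal.ofReal (noiseWeight z.2 (t z.1))

lemma measurable_noiseDensity {t : Ω → ℝ} (ht : Measurable t) :
    Measurable fun z : Ω × Fin 3 => noiseWeight z.2 (t z.1) :=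
  measurable_from_prod_countable_left fun e => (measurable_noiseWeight e).comp ht

lemma lintegral_prod_count (ρ : Measure Ω) [SFinite ρ] {F : Ω × Fin 3 → ℝ≥0∞}
    (hF : Measurable F) :
    ∫⁻ z, F z ∂(ρ.prod Measure.count) = ∫⁻ z, ∑ e, F (z, e) ∂ρ := by
  rw [lintegral_prod _ hF.aemeasurable]
  refine lintegral_congr fun z => ?_
  rw [lintegral_fintype]
  simp

lemma map_fst_noiseLaw (ρ : Measure Ω) [SFinite ρ] {t : Ω → ℝ} (ht : Measurable t)
    (hb : ∀ z, |t z| ≤ 1 / 2) : (noiseLaw ρ t).map Prod.fst = ρ := by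
  ext A hA
  rw [Measure.map_apply measurable_fst hA, noiseLaw, withDensity_apply _ (measurable_fst hA),
    ← lintegral_indicator (measurable_fst hA),
    lintegral_prod_count ρ ((measurable_noiseDensity ht).ennreal_ofReal.indicator
      (measurable_fst hA)), ← lintegral_indicator_one hA]
  refine lintegral_congr fun z => ?_
  by_cases hz : z ∈ A
  · have : ∀ e : Fin 3, (Prod.fst ⁻¹' A).indicator
        (fun z : Ω × Fin 3 => ENNReal.ofReal (noiseWeight z.2 (t z.1))) (z, e) =
        ENNReal.ofReal (noiseWeight e (t z)) := fun e => Set.indicator_of_mem (by exact hz) _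
    simp_rw [this]
    rw [← ENNReal.ofReal_sum_of_nonneg fun e _ => (noiseWeight_pos e (hb z)).le, sum_noiseWeight,
      Set.indicator_of_mem hz]
    simp
  · have : ∀ e : Fin 3, (Prod.fst ⁻¹' A).indicator
        (fun z : Ω × Fin 3 => ENNReal.ofReal (noiseWeight z.2 (t z.1))) (z, e) = 0 :=
      fun e => Set.indicator_of_notMem (by exact hz) _
    simp_rw [this]
    rw [Set.indicator_of_notMem hz]
    simp

lemma isProbabilityMeasure_noiseLaw (ρ : Measure Ω) [IsProbabilityMeasure ρ] {t : Ω → ℝ}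
    (ht : Measurable t) (hb : ∀ z, |t z| ≤ 1 / 2) : IsProbabilityMeasure (noiseLaw ρ t) := by
  refine ⟨?_⟩
  have h := congrArg (fun m : Measure Ω => m Set.univ) (map_fst_noiseLaw ρ ht hb)
  simpa [Measure.map_apply measurable_fst MeasurableSet.univ] using h

lemma integral_noiseLaw (ρ : Measure Ω) [SFinite ρ] {t : Ω → ℝ} (ht : Measurable t)
    (hb : ∀ z, |t z| ≤ 1 / 2) {F : Ω × Fin 3 → ℝ} (hF : Integrable F (noiseLaw ρ t)) :
    ∫ z, F z ∂(noiseLaw ρ t) = ∫ z, ∑ e, noiseWeight e (t z) * F (z, e) ∂ρ := by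
  have hm := (measurable_noiseDensity ht).ennreal_ofReal
  have hi := (integrable_withDensity_iff_integrable_smul' hm
    (Eventually.of_forall fun _ => ENNReal.ofReal_lt_top)).1 hF
  rw [noiseLaw, integral_withDensity_eq_integral_toReal_smul hm
    (Eventually.of_forall fun _ => ENNReal.ofReal_lt_top), integral_prod _ hi]
  refine integral_congr_ae (Eventually.of_forall fun z => ?_)
  simp only
  rw [integral_fintype (Integrable.of_finite)]
  refine Finset.sum_congr rfl fun e _ => ?_
  rw [ENNReal.toReal_ofReal (noiseWeight_pos e (hb z)).le]
  simp [Measure.real]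

/-- Restricting to an event in the first coordinate commutes with adding noise. Conditional
expectations given `(S, A)` are identified through integrals over such events. -/
lemma setIntegral_noiseLaw (ρ : Measure Ω) [SFinite ρ] {t : Ω → ℝ} (ht : Measurable t)
    (hb : ∀ z, |t z| ≤ 1 / 2) {F : Ω × Fin 3 → ℝ} (hF : Integrable F (noiseLaw ρ t))
    {A : Set Ω} (hA : MeasurableSet A) :
    ∫ z in Prod.fst ⁻¹' A, F z ∂(noiseLaw ρ t) =
      ∫ z in A, ∑ e, noiseWeight e (t z) * F (z, e) ∂ρ := by
  have h : (noiseLaw ρ t).restrict (Prod.fst ⁻¹' A) = noiseLaw (ρ.restrict A) t := by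
    rw [noiseLaw, noiseLaw, restrict_withDensity (measurable_fst hA)]
    congr 1
    rw [← Set.prod_univ, ← Measure.prod_restrict, Measure.restrict_univ]
  rw [h]
  refine integral_noiseLaw _ ht hb ?_
  rw [← h]
  exact hF.restrict

/-- Both laws have first marginal `ρ`, so their `χ²` divergence is the `ρ`-average of the
conditional ones. -/
lemma lintegral_noiseWeight_sq_div_le (ρ : Measure Ω) [IsProbabilityMeasure ρ] {t t' : Ω → ℝ}
    (ht : Measurable t) (ht' : Measurable t') (hb : ∀ z, |t z| ≤ 1 / 2)
    (hb' : ∀ z, |t' z| ≤ 1 / 2) {η : ℝ} (hη : 0 ≤ η)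
    (h : ∫⁻ z, ENNReal.ofReal ((t' z - t z) ^ 2) ∂ρ ≤ ENNReal.ofReal η) :
    ∫⁻ z, ENNReal.ofReal (noiseWeight z.2 (t' z.1) ^ 2 / noiseWeight z.2 (t z.1))
      ∂(ρ.prod Measure.count) ≤ ENNReal.ofReal (1 + 10 * η) := by
  have hm : Measurable fun z : Ω × Fin 3 =>
      ENNReal.ofReal (noiseWeight z.2 (t' z.1) ^ 2 / noiseWeight z.2 (t z.1)) :=
    (((measurable_noiseDensity ht').pow_const 2).div (measurable_noiseDensity ht)).ennreal_ofReal
  rw [lintegral_prod_count ρ hm]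
  calc _ ≤ ∫⁻ z, (1 + ENNReal.ofReal 10 * ENNReal.ofReal ((t' z - t z) ^ 2)) ∂ρ := by
        refine lintegral_mono fun z => ?_
        simp only
        rw [← ENNReal.ofReal_sum_of_nonneg fun e _ =>
          div_nonneg (sq_nonneg _) (noiseWeight_pos e (hb z)).le,
          ← ENNReal.ofReal_mul (by norm_num), ← ENNReal.ofReal_one,
          ← ENNReal.ofReal_add zero_le_one (by positivity)]
        exact ENNReal.ofReal_le_ofReal (sum_noiseWeight_sq_div_le (hb z) (hb' z))
    _ = 1 + ENNReal.ofReal 10 * ∫⁻ z, ENNReal.ofReal ((t' z - t z) ^ 2) ∂ρ := by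
        rw [lintegral_add_left measurable_const, lintegral_const_mul' _ _
          ENNReal.ofReal_ne_top]
        simp
    _ ≤ 1 + ENNReal.ofReal 10 * ENNReal.ofReal η := by gcongr
    _ = _ := by
        rw [← ENNReal.ofReal_mul (by norm_num), ← ENNReal.ofReal_one,
          ← ENNReal.ofReal_add zero_le_one (by positivity)]

end Noise

/-! ### Visitation density, transition law and the size of `h^π` -/

section DecisionProcess

variable {m k : ℕ} {lo hi : StateAction m k}

lemma measurable_stateOf : Measurable (stateOf : StateAction m k → State m) :=
  measurable_pi_lambda _ fun _ => measurable_pi_apply _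

lemma measurable_actionOf : Measurable (actionOf : StateAction m k → Action k) :=
  measurable_pi_lambda _ fun _ => measurable_pi_apply _

lemma measurable_sumElim :
    Measurable fun p : State m × Action k => (Sum.elim p.1 p.2 : StateAction m k) := by
  refine measurable_pi_lambda _ fun i => ?_
  cases i with
  | inl i => exact (measurable_pi_apply i).comp measurable_fst
  | inr i => exact (measurable_pi_apply i).comp measurable_snd

lemma measurableSet_pairSpace : MeasurableSet (pairSpace lo hi) := measurableSet_Icc

lemma measurableSet_stateSpace : MeasurableSet (stateSpace lo hi) := measurableSet_Icc

lemma measurableSet_actionSpace : MeasurableSet (actionSpace lo hi) := measurableSet_Icc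

lemma sumElim_mem_pairSpace {s : State m} {a : Action k} :
    (Sum.elim s a : StateAction m k) ∈ pairSpace lo hi ↔
      s ∈ stateSpace lo hi ∧ a ∈ actionSpace lo hi := by
  simp only [pairSpace, stateSpace, actionSpace, Set.mem_Icc, Pi.le_def, Sum.forall, Sum.elim_inl,
    Sum.elim_inr, stateOf, actionOf]
  tauto

lemma setLIntegral_pairSpace {F : StateAction m k → ℝ≥0∞} (hF : Measurable F) :
    ∫⁻ x in pairSpace lo hi, F x =
      ∫⁻ s in stateSpace lo hi, ∫⁻ a in actionSpace lo hi, F (Sum.elim s a) := by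
  have hmp := volume_measurePreserving_sumPiEquivProdPi_symm (fun _ : Fin m ⊕ Fin k => ℝ)
  have he : ∀ p : State m × Action k,
      (MeasurableEquiv.sumPiEquivProdPi fun _ : Fin m ⊕ Fin k => ℝ).symm p =
        Sum.elim p.1 p.2 := fun p => by
    ext i
    cases i <;> rfl
  rw [← hmp.setLIntegral_comp_preimage measurableSet_pairSpace hF]
  have hpre : (MeasurableEquiv.sumPiEquivProdPi fun _ : Fin m ⊕ Fin k => ℝ).symm ⁻¹'
      pairSpace lo hi = stateSpace lo hi ×ˢ actionSpace lo hi := by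
    ext p
    rw [Set.mem_preimage, he, sumElim_mem_pairSpace, Set.mem_prod]
  rw [hpre, Measure.volume_eq_prod, ← Measure.prod_restrict]
  simp_rw [he]
  exact lintegral_prod _ (hF.comp measurable_sumElim).aemeasurable

variable {μ₀ : State m → ℝ} {ν π : State m → Action k → ℝ} {q : StateAction m k → State m → ℝ}

lemma IsPolicy.measurable_comp (hν : IsPolicy lo hi ν) :
    Measurable fun x : StateAction m k => ENNReal.ofReal (ν (stateOf x) (actionOf x)) :=
  (hν.measurable.comp (measurable_stateOf.prodMk measurable_actionOf)).ennreal_ofReal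

lemma IsPolicy.measurable_apply (hν : IsPolicy lo hi ν) (s : State m) :
    Measurable fun a => ENNReal.ofReal (ν s a) :=
  (hν.measurable.comp (measurable_const.prodMk measurable_id)).ennreal_ofReal

lemma IsTransition.measurable_apply (hq : IsTransition lo hi q) (x : StateAction m k) :
    Measurable fun s' => ENNReal.ofReal (q x s') :=
  (hq.measurable.comp (measurable_const.prodMk measurable_id)).ennreal_ofReal

lemma setLIntegral_mul_policy (hν : IsPolicy lo hi ν) {g : State m → ℝ≥0∞} (hg : Measurable g) :
    ∫⁻ x in pairSpace lo hi, g (stateOf x) * ENNReal.ofReal (ν (stateOf x) (actionOf x)) =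
      ∫⁻ s in stateSpace lo hi, g s := by
  have hm : Measurable fun x : StateAction m k =>
      g (stateOf x) * ENNReal.ofReal (ν (stateOf x) (actionOf x)) :=
    (hg.comp measurable_stateOf).mul hν.measurable_comp
  rw [setLIntegral_pairSpace hm]
  refine setLIntegral_congr_fun measurableSet_stateSpace fun s hs => ?_
  have : ∫⁻ a in actionSpace lo hi, g s * ENNReal.ofReal (ν s a) = g s := by
    rw [lintegral_const_mul _ (hν.measurable_apply s), hν.lintegral_eq_one s hs, mul_one]
  exact this

lemma measurable_stateDensityAt (hμ₀ : IsStateDensity lo hi μ₀) (hν : IsPolicy lo hi ν)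
    (hq : IsTransition lo hi q) (t : ℕ) : Measurable (stateDensityAt lo hi μ₀ ν q t) := by
  induction t with
  | zero => exact hμ₀.measurable.ennreal_ofReal
  | succ t ih =>
    refine Measurable.lintegral_prod_right' (f := fun p : State m × StateAction m k =>
      stateDensityAt lo hi μ₀ ν q t (stateOf p.2) *
        ENNReal.ofReal (ν (stateOf p.2) (actionOf p.2)) * ENNReal.ofReal (q p.2 p.1)) ?_
    exact ((ih.comp (measurable_stateOf.comp measurable_snd)).mul
      (hν.measurable_comp.comp measurable_snd)).mul
        (hq.measurable.comp (measurable_snd.prodMk measurable_fst)).ennreal_ofReal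

lemma lintegral_stateDensityAt (hμ₀ : IsStateDensity lo hi μ₀) (hν : IsPolicy lo hi ν)
    (hq : IsTransition lo hi q) (t : ℕ) :
    ∫⁻ s in stateSpace lo hi, stateDensityAt lo hi μ₀ ν q t s = 1 := by
  induction t with
  | zero => exact hμ₀.lintegral_eq_one
  | succ t ih =>
    have hm := measurable_stateDensityAt hμ₀ hν hq t
    have hm' := (hm.comp measurable_stateOf).mul hν.measurable_comp
    change ∫⁻ s' in stateSpace lo hi, ∫⁻ x in pairSpace lo hi,
      stateDensityAt lo hi μ₀ ν q t (stateOf x) * ENNReal.ofReal (ν (stateOf x) (actionOf x)) *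
        ENNReal.ofReal (q x s') = 1
    rw [lintegral_lintegral_swap]
    · rw [← ih, ← setLIntegral_mul_policy hν hm]
      refine setLIntegral_congr_fun measurableSet_pairSpace fun x hx => ?_
      rw [lintegral_const_mul _ (hq.measurable_apply x), hq.lintegral_eq_one x hx, mul_one]
    · exact ((hm'.comp measurable_snd).mul
        (hq.measurable.comp (measurable_snd.prodMk measurable_fst)).ennreal_ofReal).aemeasurable

lemma measurable_avgVisitation (hμ₀ : IsStateDensity lo hi μ₀) (hν : IsPolicy lo hi ν)
    (hq : IsTransition lo hi q) (H : ℕ) : Measurable (avgVisitation lo hi μ₀ ν q H) := by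
  unfold avgVisitation
  exact (Finset.measurable_sum _ fun t _ => ((measurable_stateDensityAt hμ₀ hν hq t).comp
    measurable_stateOf).mul hν.measurable_comp).const_mul _

lemma lintegral_avgVisitation (hμ₀ : IsStateDensity lo hi μ₀) (hν : IsPolicy lo hi ν)
    (hq : IsTransition lo hi q) {H : ℕ} (hH : 1 ≤ H) :
    ∫⁻ x in pairSpace lo hi, avgVisitation lo hi μ₀ ν q H x = 1 := by
  have hm : ∀ t, Measurable fun x : StateAction m k => stateDensityAt lo hi μ₀ ν q t (stateOf x) *
      ENNReal.ofReal (ν (stateOf x) (actionOf x)) := fun t =>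
    ((measurable_stateDensityAt hμ₀ hν hq t).comp measurable_stateOf).mul hν.measurable_comp
  unfold avgVisitation
  rw [lintegral_const_mul _ (Finset.measurable_sum _ fun t _ => hm t),
    lintegral_finsetSum _ fun t _ => hm t]
  simp_rw [setLIntegral_mul_policy hν (measurable_stateDensityAt hμ₀ hν hq _),
    lintegral_stateDensityAt hμ₀ hν hq]
  simp only [Finset.sum_const, Finset.card_range, nsmul_eq_mul, mul_one]
  exact ENNReal.inv_mul_cancel (by exact_mod_cast (by omega : H ≠ 0)) (ENNReal.natCast_ne_top H)

/-- The law of `((S, A), S')` when `(S, A)` has density `d` and `S'` has density `q`. -/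
noncomputable def transitionLaw (lo hi : StateAction m k) (d : StateAction m k → ℝ≥0∞)
    (q : StateAction m k → State m → ℝ) : Measure (StateAction m k × State m) :=
  ((volume.restrict (pairSpace lo hi)).prod (volume.restrict (stateSpace lo hi))).withDensity
    fun w => d w.1 * ENNReal.ofReal (q w.1 w.2)

section TransitionLaw

variable {d : StateAction m k → ℝ≥0∞} (hd : Measurable d) (hq : IsTransition lo hi q)

include hd hq

lemma measurable_transitionDensity :
    Measurable fun w : StateAction m k × State m => d w.1 * ENNReal.ofReal (q w.1 w.2) :=
  (hd.comp measurable_fst).mul hq.measurable.ennreal_ofReal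

lemma lintegral_transitionLaw {F : StateAction m k × State m → ℝ≥0∞} (hF : Measurable F) :
    ∫⁻ z, F z ∂(transitionLaw lo hi d q) = ∫⁻ x in pairSpace lo hi, d x *
      ∫⁻ s' in stateSpace lo hi, ENNReal.ofReal (q x s') * F (x, s') := by
  have hm := measurable_transitionDensity hd hq
  rw [transitionLaw, lintegral_withDensity_eq_lintegral_mul _ hm hF,
    lintegral_prod _ (hm.mul hF).aemeasurable]
  refine lintegral_congr fun x => ?_
  simp only [Pi.mul_apply, mul_assoc]
  refine lintegral_const_mul _ ?_
  exact (hq.measurable_apply x).mul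
    (hF.comp (measurable_const.prodMk measurable_id))

lemma lintegral_transitionLaw_fst {F : StateAction m k → ℝ≥0∞} (hF : Measurable F) :
    ∫⁻ z, F z.1 ∂(transitionLaw lo hi d q) = ∫⁻ x in pairSpace lo hi, d x * F x := by
  rw [lintegral_transitionLaw hd hq (F := fun z => F z.1) (hF.comp measurable_fst)]
  refine setLIntegral_congr_fun measurableSet_pairSpace fun x hx => ?_
  simp only
  rw [lintegral_mul_const _ (hq.measurable_apply x), hq.lintegral_eq_one x hx, one_mul]

lemma isProbabilityMeasure_transitionLaw (h1 : ∫⁻ x in pairSpace lo hi, d x = 1) :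
    IsProbabilityMeasure (transitionLaw lo hi d q) := by
  refine ⟨?_⟩
  have := lintegral_transitionLaw_fst hd hq (F := fun _ => 1) measurable_const
  simpa [h1] using this

lemma ae_mem_transitionLaw :
    ∀ᵐ z ∂(transitionLaw lo hi d q), z.1 ∈ pairSpace lo hi ∧ z.2 ∈ stateSpace lo hi := by
  refine (withDensity_absolutelyContinuous _ _).ae_le ?_
  rw [Measure.prod_restrict]
  filter_upwards [ae_restrict_mem (measurableSet_pairSpace.prod measurableSet_stateSpace)] with z hz
  exact hz

lemma integrable_fst_transitionLaw {p₁ : ℝ} (hd1 : ∀ x ∈ pairSpace lo hi, d x ≤ ENNReal.ofReal p₁)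
    {v : StateAction m k → ℝ} (hv : Measurable v) (hvi : IntegrableOn v (pairSpace lo hi)) :
    Integrable (fun z => v z.1) (transitionLaw lo hi d q) := by
  refine ⟨(hv.comp measurable_fst).aestronglyMeasurable, ?_⟩
  rw [HasFiniteIntegral, lintegral_transitionLaw_fst hd hq hv.enorm]
  refine (setLIntegral_mono (hv.enorm.const_mul _) fun x hx =>
    mul_le_mul_left (hd1 x hx) _).trans_lt ?_
  rw [lintegral_const_mul _ hv.enorm]
  exact ENNReal.mul_lt_top ENNReal.ofReal_lt_top hvi.2

end TransitionLaw

/-! ### The function `h^π` -/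

lemma measurable_hFun (hπ : IsPolicy lo hi π) (γ : ℝ) {Q : StateAction m k → ℝ}
    (hQ : Continuous Q) :
    Measurable fun z : StateAction m k × State m => hFun lo hi π γ Q z.1 z.2 := by
  have h : StronglyMeasurable fun s' : State m =>
      ∫ a' in actionSpace lo hi, π s' a' * Q (Sum.elim s' a') :=
    StronglyMeasurable.integral_prod_right' (f := fun p : State m × Action k =>
      π p.1 p.2 * Q (Sum.elim p.1 p.2))
      (hπ.measurable.mul (hQ.measurable.comp measurable_sumElim)).stronglyMeasurable
  exact (hQ.measurable.comp measurable_fst).sub ((h.measurable.comp measurable_snd).const_mul γ)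

section Policy

variable (hπ : IsPolicy lo hi π) {s' : State m} (hs' : s' ∈ stateSpace lo hi)

/-- The distribution `π(· | s)`. -/
noncomputable def policyLaw (lo hi : StateAction m k) (π : State m → Action k → ℝ) (s : State m) :
    Measure (Action k) :=
  (volume.restrict (actionSpace lo hi)).withDensity fun a => ENNReal.ofReal (π s a)

include hπ hs'

lemma isProbabilityMeasure_policyLaw : IsProbabilityMeasure (policyLaw lo hi π s') :=
  ⟨by rw [policyLaw, withDensity_apply _ MeasurableSet.univ, Measure.restrict_univ,
    hπ.lintegral_eq_one s' hs']⟩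

lemma integral_policyLaw (f : Action k → ℝ) :
    ∫ a, f a ∂(policyLaw lo hi π s') = ∫ a in actionSpace lo hi, π s' a * f a := by
  rw [policyLaw, integral_withDensity_eq_integral_toReal_smul
    (hπ.measurable_apply s') (Eventually.of_forall fun _ => ENNReal.ofReal_lt_top)]
  refine setIntegral_congr_fun measurableSet_actionSpace fun a ha => ?_
  simp only [smul_eq_mul]
  rw [ENNReal.toReal_ofReal (hπ.nonneg s' hs' a ha)]

lemma hFun_eq (γ : ℝ) (Q : StateAction m k → ℝ) (x : StateAction m k) :
    hFun lo hi π γ Q x s' = Q x - γ * ∫ a, Q (Sum.elim s' a) ∂(policyLaw lo hi π s') := by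
  rw [integral_policyLaw hπ hs', hFun]

lemma integrable_policyLaw {Q : StateAction m k → ℝ} (hQ : Measurable Q) {B : ℝ}
    (hB : ∀ x, |Q x| ≤ B) : Integrable (fun a => Q (Sum.elim s' a)) (policyLaw lo hi π s') := by
  have := isProbabilityMeasure_policyLaw hπ hs'
  refine Integrable.of_bound (hQ.comp (measurable_sumElim.comp (measurable_const.prodMk
    measurable_id))).aestronglyMeasurable B (Eventually.of_forall fun a => hB _)

lemma abs_hFun_le {γ : ℝ} (hγ0 : 0 ≤ γ) (hγ1 : γ < 1) {Q : StateAction m k → ℝ} {B : ℝ}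
    (hB : ∀ x, |Q x| ≤ B) (x : StateAction m k) : |hFun lo hi π γ Q x s'| ≤ 2 * B := by
  have := isProbabilityMeasure_policyLaw hπ hs'
  rw [hFun_eq hπ hs']
  have h1 : |∫ a, Q (Sum.elim s' a) ∂(policyLaw lo hi π s')| ≤ B := by
    have := norm_integral_le_of_norm_le_const (μ := policyLaw lo hi π s')
      (f := fun a => Q (Sum.elim s' a)) (C := B) (Eventually.of_forall fun a => hB _)
    simpa using this
  refine (abs_sub _ _).trans ?_
  rw [abs_mul, abs_of_nonneg hγ0]
  have hB0 : 0 ≤ B := (abs_nonneg _).trans (hB x)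
  have h2 := mul_le_mul hγ1.le h1 (abs_nonneg _) zero_le_one
  linarith [hB x]

lemma hFun_sub (γ : ℝ) {Q Q' : StateAction m k → ℝ} (hQ : Measurable Q) (hQ' : Measurable Q')
    {B : ℝ} (hB : ∀ x, |Q x| ≤ B) (hB' : ∀ x, |Q' x| ≤ B) (x : StateAction m k) :
    hFun lo hi π γ Q x s' - hFun lo hi π γ Q' x s' =
      hFun lo hi π γ (fun y => Q y - Q' y) x s' := by
  rw [hFun_eq hπ hs', hFun_eq hπ hs', hFun_eq hπ hs',
    integral_sub (integrable_policyLaw hπ hs' hQ hB) (integrable_policyLaw hπ hs' hQ' hB')]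
  ring

/-- Combine `(x - y)² ≤ 2 (x² + y²)`, `γ < 1` and Jensen's inequality for the probability measure
`π(· | s')`. -/
lemma ofReal_hFun_sq_le {γ : ℝ} (hγ0 : 0 ≤ γ) (hγ1 : γ < 1) {Q : StateAction m k → ℝ}
    (hQ : Measurable Q) {B : ℝ} (hB : ∀ x, |Q x| ≤ B) (x : StateAction m k) :
    ENNReal.ofReal (hFun lo hi π γ Q x s' ^ 2) ≤ 2 * (ENNReal.ofReal (Q x ^ 2) +
      ∫⁻ a in actionSpace lo hi, ENNReal.ofReal (π s' a) * ENNReal.ofReal (Q (Sum.elim s' a) ^ 2)) := by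
  have := isProbabilityMeasure_policyLaw hπ hs'
  have hi1 := integrable_policyLaw hπ hs' hQ hB
  have hi2 : Integrable (fun a => Q (Sum.elim s' a) ^ 2) (policyLaw lo hi π s') :=
    integrable_policyLaw hπ hs' (Q := fun x => Q x ^ 2) (hQ.pow_const 2) (B := B ^ 2) fun x => by
      rw [abs_pow]; exact pow_le_pow_left₀ (abs_nonneg _) (hB x) 2
  have hQm : Measurable fun a : Action k => ENNReal.ofReal (Q (Sum.elim s' a) ^ 2) :=
    ((hQ.comp (measurable_sumElim.comp (measurable_const.prodMk
      measurable_id))).pow_const 2).ennreal_ofReal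
  set b := ∫ a, Q (Sum.elim s' a) ∂(policyLaw lo hi π s') with hb
  have hjensen : b ^ 2 ≤ ∫ a, Q (Sum.elim s' a) ^ 2 ∂(policyLaw lo hi π s') := by
    -- Jensen's inequality for the square is nonnegativity of the variance.
    have h0 : 0 ≤ ∫ a, (Q (Sum.elim s' a) ^ 2 - 2 * b * Q (Sum.elim s' a) + b ^ 2)
        ∂(policyLaw lo hi π s') := integral_nonneg fun a => by
      have := sq_nonneg (Q (Sum.elim s' a) - b)
      simp only [Pi.zero_apply]
      nlinarith
    have hi3 : Integrable (fun a => Q (Sum.elim s' a) ^ 2 - 2 * b * Q (Sum.elim s' a))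
        (policyLaw lo hi π s') := hi2.sub (hi1.const_mul _)
    rw [integral_add hi3 (integrable_const _), integral_sub hi2 (hi1.const_mul _), integral_const_mul, ← hb] at h0
    simp only [integral_const, probReal_univ, one_smul] at h0
    linarith
  have hreal : hFun lo hi π γ Q x s' ^ 2 ≤
      2 * (Q x ^ 2 + ∫ a, Q (Sum.elim s' a) ^ 2 ∂(policyLaw lo hi π s')) := by
    rw [hFun_eq hπ hs', ← hb]
    have h1 : (γ * b) ^ 2 ≤ b ^ 2 := by
      rw [mul_pow]
      exact mul_le_of_le_one_left (sq_nonneg b) (pow_le_one₀ hγ0 hγ1.le)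
    nlinarith [sq_nonneg (Q x + γ * b)]
  refine (ENNReal.ofReal_le_ofReal hreal).trans (le_of_eq ?_)
  rw [ENNReal.ofReal_mul zero_le_two, ENNReal.ofReal_ofNat,
    ENNReal.ofReal_add (sq_nonneg _) (integral_nonneg fun a => sq_nonneg _),
    ofReal_integral_eq_lintegral_ofReal hi2 (Eventually.of_forall fun a => sq_nonneg _), policyLaw,
    lintegral_withDensity_eq_lintegral_mul _ (hπ.measurable_apply s') hQm]
  rfl

end Policy

/-- `E[h^π(S, A, S'; Q)²]` is at most a multiple of the squared `L²` norm of `Q`. -/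
lemma lintegral_hFun_sq_le (hπ : IsPolicy lo hi π) (hq : IsTransition lo hi q)
    {d : StateAction m k → ℝ≥0∞} (hd : Measurable d) (h1 : ∫⁻ x in pairSpace lo hi, d x = 1)
    {p₁ p₂ : ℝ} (hd1 : ∀ x ∈ pairSpace lo hi, d x ≤ ENNReal.ofReal p₁)
    (hqπ : ∀ x ∈ pairSpace lo hi, ∀ s' ∈ stateSpace lo hi, ∀ a' ∈ actionSpace lo hi,
      q x s' * π s' a' ≤ p₂)
    {γ : ℝ} (hγ0 : 0 ≤ γ) (hγ1 : γ < 1) {Q : StateAction m k → ℝ} (hQ : Continuous Q) {B : ℝ}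
    (hB : ∀ x, |Q x| ≤ B) :
    ∫⁻ z, ENNReal.ofReal (hFun lo hi π γ Q z.1 z.2 ^ 2) ∂(transitionLaw lo hi d q) ≤
      2 * ((ENNReal.ofReal p₁ + ENNReal.ofReal p₂) *
        ∫⁻ x in pairSpace lo hi, ENNReal.ofReal (Q x ^ 2)) := by
  have hQm : Measurable fun x => ENNReal.ofReal (Q x ^ 2) :=
    (hQ.measurable.pow_const 2).ennreal_ofReal
  set G : State m → ℝ≥0∞ := fun s' => ∫⁻ a in actionSpace lo hi,
    ENNReal.ofReal (π s' a) * ENNReal.ofReal (Q (Sum.elim s' a) ^ 2) with hG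
  have hGm : Measurable G := Measurable.lintegral_prod_right'
    (f := fun p : State m × Action k =>
      ENNReal.ofReal (π p.1 p.2) * ENNReal.ofReal (Q (Sum.elim p.1 p.2) ^ 2))
    (hπ.measurable.ennreal_ofReal.mul (hQm.comp measurable_sumElim))
  set I := ∫⁻ x in pairSpace lo hi, ENNReal.ofReal (Q x ^ 2) with hI
  have hpart1 : ∫⁻ z, ENNReal.ofReal (Q z.1 ^ 2) ∂(transitionLaw lo hi d q) ≤
      ENNReal.ofReal p₁ * I := by
    rw [lintegral_transitionLaw_fst hd hq hQm, hI, ← lintegral_const_mul _ hQm]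
    exact setLIntegral_mono (hQm.const_mul _) fun x hx => mul_le_mul_left (hd1 x hx) _
  have hpart2 : ∫⁻ z, G z.2 ∂(transitionLaw lo hi d q) ≤ ENNReal.ofReal p₂ * I := by
    rw [lintegral_transitionLaw hd hq (F := fun z => G z.2) (hGm.comp measurable_snd)]
    -- Bounding the joint density `q(s' | x) π(a' | s')` of the next pair by `p₂` replaces it by
    -- Lebesgue measure, uniformly in `x`.
    have hin : ∀ x ∈ pairSpace lo hi,
        ∫⁻ s' in stateSpace lo hi, ENNReal.ofReal (q x s') * G s' ≤ ENNReal.ofReal p₂ * I := by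
      intro x hx
      rw [hI, setLIntegral_pairSpace hQm, ← lintegral_const_mul' _ _ ENNReal.ofReal_ne_top]
      refine setLIntegral_mono' measurableSet_stateSpace fun s' hs' => ?_
      rw [hG, ← lintegral_const_mul' _ _ ENNReal.ofReal_ne_top,
        ← lintegral_const_mul' _ _ ENNReal.ofReal_ne_top]
      refine setLIntegral_mono' measurableSet_actionSpace fun a ha => ?_
      rw [← mul_assoc, ← ENNReal.ofReal_mul (hq.nonneg x hx s' hs')]
      exact mul_le_mul_left (ENNReal.ofReal_le_ofReal (hqπ x hx s' hs' a ha)) _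
    calc _ ≤ ∫⁻ x in pairSpace lo hi, d x * (ENNReal.ofReal p₂ * I) :=
          setLIntegral_mono' measurableSet_pairSpace fun x hx => mul_le_mul_right (hin x hx) _
      _ = _ := by rw [lintegral_mul_const _ hd, h1, one_mul]
  calc _ ≤ ∫⁻ z, 2 * (ENNReal.ofReal (Q z.1 ^ 2) + G z.2) ∂(transitionLaw lo hi d q) := by
        refine lintegral_mono_ae ?_
        filter_upwards [ae_mem_transitionLaw hd hq] with z hz
        exact ofReal_hFun_sq_le hπ hz.2 hγ0 hγ1 hQ.measurable hB z.1
    _ = 2 * (∫⁻ z, ENNReal.ofReal (Q z.1 ^ 2) ∂(transitionLaw lo hi d q) +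
          ∫⁻ z, G z.2 ∂(transitionLaw lo hi d q)) := by
        rw [lintegral_const_mul' _ _ (by norm_num),
          lintegral_add_left (f := fun z : StateAction m k × State m => ENNReal.ofReal (Q z.1 ^ 2))
            (hQm.comp measurable_fst)]
    _ ≤ 2 * (ENNReal.ofReal p₁ * I + ENNReal.ofReal p₂ * I) := by gcongr
    _ = _ := by rw [← add_mul]

end DecisionProcess

/-! ### The reward laws and their `χ²` divergence -/

section RewardLaw

variable {m k : ℕ} {lo hi : StateAction m k}

/-- The tuple with reward `2 √w(s, a) e` for the noise value `e`. -/
noncomputable def rewardMap (w : StateAction m k → ℝ) (z : (StateAction m k × State m) × Fin 3) :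
    Tuple m k :=
  (z.1.1, 2 * Real.sqrt (w z.1.1) * noiseValue z.2, z.1.2)

lemma measurable_rewardMap {w : StateAction m k → ℝ} (hw : Measurable w) :
    Measurable (rewardMap w) := by
  have hv : Measurable noiseValue := measurable_of_countable _
  exact (measurable_fst.comp measurable_fst).prodMk
    ((((hw.comp (measurable_fst.comp measurable_fst)).sqrt.const_mul 2).mul
      (hv.comp measurable_snd)).prodMk (measurable_snd.comp measurable_fst))

open Classical in
/-- The standardised signal `h^π / √w`. -/
noncomputable def signal (lo hi : StateAction m k) (π : State m → Action k → ℝ) (γ : ℝ)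
    (w Q : StateAction m k → ℝ) (z : StateAction m k × State m) : ℝ :=
  -- Off the state space `π` need not be a density, so `h^π` is uncontrolled there. The value 0
  -- makes the bound `1/2` hold everywhere and changes only a null set.
  if z.2 ∈ stateSpace lo hi then hFun lo hi π γ Q z.1 z.2 / Real.sqrt (w z.1) else 0

variable {π : State m → Action k → ℝ} {q : StateAction m k → State m → ℝ}
  {d : StateAction m k → ℝ≥0∞} {γ : ℝ} {w Q : StateAction m k → ℝ}

lemma measurable_signal (hπ : IsPolicy lo hi π) (hw : Measurable w) (hQ : Continuous Q) :
    Measurable (signal lo hi π γ w Q) :=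
  Measurable.ite (measurable_snd measurableSet_stateSpace)
    ((measurable_hFun hπ γ hQ).div (hw.comp measurable_fst).sqrt) measurable_const

lemma abs_signal_le (hπ : IsPolicy lo hi π) (hγ0 : 0 ≤ γ) (hγ1 : γ < 1) {σ : ℝ} (hσ : 0 < σ)
    (hwσ : ∀ x, σ ^ 2 ≤ w x) {B : ℝ} (hB : ∀ x, |Q x| ≤ B) (hBσ : 4 * B ≤ σ)
    (z : StateAction m k × State m) : |signal lo hi π γ w Q z| ≤ 1 / 2 := by
  unfold signal
  split_ifs with h
  · have h1 := abs_hFun_le hπ h hγ0 hγ1 hB z.1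
    have h2 : σ ≤ Real.sqrt (w z.1) := Real.le_sqrt_of_sq_le (hwσ _)
    rw [abs_div, abs_of_nonneg (Real.sqrt_nonneg _), div_le_iff₀ (hσ.trans_le h2)]
    linarith
  · norm_num

/-- The law of the tuple with signal `h^π(·; Q)` and conditional error variance `w`. -/
noncomputable def rewardLaw (lo hi : StateAction m k) (d : StateAction m k → ℝ≥0∞)
    (q : StateAction m k → State m → ℝ) (π : State m → Action k → ℝ) (γ : ℝ)
    (w Q : StateAction m k → ℝ) : Measure (Tuple m k) :=
  (noiseLaw (transitionLaw lo hi d q) (signal lo hi π γ w Q)).map (rewardMap w)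

/-- Averages out the noise on events generated by `(S, A)`. The function `G` is an explicit version
of `f ∘ rewardMap w`; for the model error the two agree only almost everywhere. -/
lemma integral_map_rewardMap {ρ : Measure (StateAction m k × State m)} [SFinite ρ]
    {t : StateAction m k × State m → ℝ} (ht : Measurable t) (hb : ∀ z, |t z| ≤ 1 / 2)
    (hw : Measurable w) {f : Tuple m k → ℝ} (hf : Measurable f)
    {G : (StateAction m k × State m) × Fin 3 → ℝ}
    (hfG : ∀ᵐ z ∂(noiseLaw ρ t), f (rewardMap w z) = G z) (hG : Integrable G (noiseLaw ρ t)) :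
    Integrable f ((noiseLaw ρ t).map (rewardMap w)) ∧
    ∀ A : Set (StateAction m k), MeasurableSet A →
      ∫ z in Prod.fst ⁻¹' A, f z ∂((noiseLaw ρ t).map (rewardMap w)) =
        ∫ z in Prod.fst ⁻¹' A, ∑ e, noiseWeight e (t z) * G (z, e) ∂ρ := by
  have hT := measurable_rewardMap hw
  refine ⟨?_, fun A hA => ?_⟩
  · rw [integrable_map_measure hf.aestronglyMeasurable hT.aemeasurable]
    exact hG.congr (hfG.mono fun z hz => hz.symm)
  · rw [setIntegral_map (measurable_fst hA) hf.aestronglyMeasurable hT.aemeasurable,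
      ← setIntegral_noiseLaw ρ ht hb hG (measurable_fst hA)]
    exact setIntegral_congr_ae (measurable_fst (measurable_fst hA)) (hfG.mono fun z hz _ => hz)

/-- The noise weights give the error mean 0 and variance `w(S, A)` conditionally on all of `(S, A,
S')`, although `h^π` depends on `S'`. Integrating over events in `(S, A)` then identifies both
conditional expectations. -/
theorem isModelLaw_rewardLaw (hπ : IsPolicy lo hi π) (hq : IsTransition lo hi q)
    (hd : Measurable d) (h1 : ∫⁻ x in pairSpace lo hi, d x = 1) {p₁ : ℝ}
    (hd1 : ∀ x ∈ pairSpace lo hi, d x ≤ ENNReal.ofReal p₁) (hγ0 : 0 ≤ γ) (hγ1 : γ < 1)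
    {σ : ℝ} (hσ : 0 < σ) (hw : Measurable w) (hwσ : ∀ x, σ ^ 2 ≤ w x)
    (hwi : IntegrableOn w (pairSpace lo hi)) (hQ : Continuous Q) {B : ℝ} (hB : ∀ x, |Q x| ≤ B)
    (hBσ : 4 * B ≤ σ) {v : StateAction m k → ℝ} (hvw : ∀ x ∈ pairSpace lo hi, v x = w x) :
    IsModelLaw lo hi d q π γ v Q (rewardLaw lo hi d q π γ w Q) := by
  set ρ := transitionLaw lo hi d q with hρ
  have hρp : IsProbabilityMeasure ρ := isProbabilityMeasure_transitionLaw hd hq h1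
  set t := signal lo hi π γ w Q with ht_def
  have ht : Measurable t := measurable_signal hπ hw hQ
  have hb : ∀ z, |t z| ≤ 1 / 2 := abs_signal_le hπ hγ0 hγ1 hσ hwσ hB hBσ
  set N := noiseLaw ρ t with hN
  have hNp : IsProbabilityMeasure N := isProbabilityMeasure_noiseLaw ρ ht hb
  have hT := measurable_rewardMap hw
  have hPdef : rewardLaw lo hi d q π γ w Q = N.map (rewardMap w) := rfl
  have hPp : IsProbabilityMeasure (N.map (rewardMap w)) :=
    Measure.isProbabilityMeasure_map hT.aemeasurable
  have hw0 : ∀ x, 0 < w x := fun x => (pow_pos hσ 2).trans_le (hwσ x)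
  have hNfst : N.map Prod.fst = ρ := map_fst_noiseLaw ρ ht hb
  have hmemN : ∀ᵐ z ∂N, z.1.1 ∈ pairSpace lo hi ∧ z.1.2 ∈ stateSpace lo hi := by
    refine ae_of_ae_map (f := Prod.fst) (p := fun z : StateAction m k × State m =>
      z.1 ∈ pairSpace lo hi ∧ z.2 ∈ stateSpace lo hi) measurable_fst.aemeasurable ?_
    rw [hNfst]
    exact ae_mem_transitionLaw hd hq
  have hwN : Integrable (fun z : (StateAction m k × State m) × Fin 3 => w z.1.1) N := by
    have h := integrable_fst_transitionLaw hd hq hd1 hw hwi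
    rw [← hρ, ← hNfst] at h
    exact (integrable_map_measure (g := fun z : StateAction m k × State m => w z.1)
      (hw.comp measurable_fst).aestronglyMeasurable measurable_fst.aemeasurable).1 h
  set U : (StateAction m k × State m) × Fin 3 → ℝ := fun z =>
    2 * Real.sqrt (w z.1.1) * noiseValue z.2 - t z.1 * Real.sqrt (w z.1.1) with hU
  have hUm : Measurable U :=
    (measurable_fst.comp (measurable_snd.comp hT)).sub
      ((ht.comp measurable_fst).mul (hw.comp (measurable_fst.comp measurable_fst)).sqrt)
  -- Since `|2 e - t| ≤ 5/2`, the square is at most `25/4 < 7`.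
  have hUsq : ∀ z, U z ^ 2 ≤ 7 * w z.1.1 := by
    intro z
    have e1 : U z ^ 2 = w z.1.1 * (2 * noiseValue z.2 - t z.1) ^ 2 := by
      conv_rhs => rw [← Real.sq_sqrt (hw0 z.1.1).le]
      simp only [hU]
      ring
    rw [e1, mul_comm]
    refine mul_le_mul_of_nonneg_right ?_ (hw0 _).le
    obtain ⟨h3, h4⟩ := abs_le.1 (abs_noiseValue_le z.2)
    obtain ⟨h5, h6⟩ := abs_le.1 (hb z.1)
    nlinarith
  have hU2i : Integrable (fun z => U z ^ 2) N := by
    refine (hwN.const_mul 7).mono' (hUm.pow_const 2).aestronglyMeasurable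
      (Eventually.of_forall fun z => ?_)
    rw [Real.norm_eq_abs, abs_of_nonneg (sq_nonneg _)]
    exact hUsq z
  have hUi : Integrable U N := by
    refine ((integrable_const 1).add hU2i).mono' hUm.aestronglyMeasurable
      (Eventually.of_forall fun z => ?_)
    rw [Real.norm_eq_abs, Pi.add_apply, ← sq_abs (U z)]
    nlinarith [sq_nonneg (|U z| - 1), abs_nonneg (U z)]
  have herr : Measurable (modelError lo hi π γ Q) :=
    (measurable_fst.comp measurable_snd).sub ((measurable_hFun hπ γ hQ).comp
      (measurable_fst.prodMk (measurable_snd.comp measurable_snd)))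
  have herrU : ∀ᵐ z ∂N, modelError lo hi π γ Q (rewardMap w z) = U z := by
    filter_upwards [hmemN] with z hz
    simp only [modelError, rewardMap, hU]
    congr 1
    rw [ht_def, signal, if_pos hz.2, div_mul_cancel₀ _ (Real.sqrt_pos.2 (hw0 _)).ne']
  obtain ⟨hE1, hE2⟩ := integral_map_rewardMap ht hb hw herr herrU hUi
  obtain ⟨hS1, hS2⟩ := integral_map_rewardMap ht hb hw (herr.pow_const 2)
    (herrU.mono fun z hz => by rw [hz]) hU2i
  obtain ⟨hW1, hW2⟩ := integral_map_rewardMap ht hb hw (f := fun z => w z.1)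
    (hw.comp measurable_fst) (G := fun z => w z.1.1) (Eventually.of_forall fun z => rfl) hwN
  have hle : pairSigma m k ≤ (inferInstance : MeasurableSpace (Tuple m k)) :=
    measurable_fst.comap_le
  rw [hPdef]
  refine ⟨hPp, ?_, hE1, ?_, hS1, ?_⟩
  · have hproj : Measurable fun z : Tuple m k => (z.1, z.2.2) :=
      measurable_fst.prodMk (measurable_snd.comp measurable_snd)
    rw [Measure.map_map hproj hT]
    exact hNfst
  · refine (ae_eq_condExp_of_forall_setIntegral_eq hle hE1
      (fun s _ _ => integrableOn_zero) ?_ stronglyMeasurable_zero.aestronglyMeasurable).symm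
    rintro _ ⟨A, hA, rfl⟩ _
    rw [hE2 A hA]
    have : ∀ z, ∑ e, noiseWeight e (t z) * U (z, e) = 0 := fun z =>
      sum_noiseWeight_mul_error (t z) (Real.sqrt (w z.1))
    simp [this]
  · have hvw' : (fun z : Tuple m k => v z.1) =ᵐ[N.map (rewardMap w)] fun z => w z.1 := by
      have : ∀ᵐ z ∂(N.map (rewardMap w)), z.1 ∈ pairSpace lo hi :=
        (ae_map_iff hT.aemeasurable (measurable_fst measurableSet_pairSpace)).2
          (hmemN.mono fun z hz => hz.1)
      exact this.mono fun z hz => hvw _ hz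
    refine EventuallyEq.trans ?_ hvw'.symm
    refine (ae_eq_condExp_of_forall_setIntegral_eq hle hS1
      (fun s _ _ => hW1.integrableOn) ?_ ?_).symm
    · rintro _ ⟨A, hA, rfl⟩ _
      rw [hS2 A hA, hW2 A hA]
      refine integral_congr_ae (Eventually.of_forall fun z => ?_)
      simp only
      rw [← Finset.sum_mul, sum_noiseWeight, one_mul]
      refine Eq.trans ?_ (sum_noiseWeight_mul_error_sq (t z) (Real.sqrt (w z.1))).symm
      rw [Real.sq_sqrt (hw0 _).le]
    · have : Measurable[pairSigma m k] fun z : Tuple m k => w z.1 :=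
        hw.comp (comap_measurable _)
      exact this.stronglyMeasurable.aestronglyMeasurable

/-- The `χ²` divergence of two signals is controlled by their `L²` distance. -/
lemma lintegral_signal_sub_sq_le (hπ : IsPolicy lo hi π) (hq : IsTransition lo hi q)
    (hd : Measurable d) (h1 : ∫⁻ x in pairSpace lo hi, d x = 1) {p₁ p₂ : ℝ} (hp₁ : 0 ≤ p₁)
    (hp₂ : 0 ≤ p₂) (hd1 : ∀ x ∈ pairSpace lo hi, d x ≤ ENNReal.ofReal p₁)
    (hqπ : ∀ x ∈ pairSpace lo hi, ∀ s' ∈ stateSpace lo hi, ∀ a' ∈ actionSpace lo hi,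
      q x s' * π s' a' ≤ p₂)
    (hγ0 : 0 ≤ γ) (hγ1 : γ < 1) {σ : ℝ} (hσ : 0 < σ) (hwσ : ∀ x, σ ^ 2 ≤ w x)
    {Q' : StateAction m k → ℝ} (hQ : Continuous Q) (hQ' : Continuous Q') {B : ℝ}
    (hB : ∀ x, |Q x| ≤ B) (hB' : ∀ x, |Q' x| ≤ B) {η : ℝ}
    (hη : ∫⁻ x in pairSpace lo hi, ENNReal.ofReal ((Q' x - Q x) ^ 2) ≤ ENNReal.ofReal η) :
    ∫⁻ z, ENNReal.ofReal ((signal lo hi π γ w Q' z - signal lo hi π γ w Q z) ^ 2)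
      ∂(transitionLaw lo hi d q) ≤ ENNReal.ofReal ((σ ^ 2)⁻¹ * (2 * ((p₁ + p₂) * η))) := by
  have hh := lintegral_hFun_sq_le hπ hq hd h1 hd1 hqπ hγ0 hγ1 (Q := fun x => Q' x - Q x)
    (hQ'.sub hQ) (B := B + B) fun x => (abs_sub _ _).trans (add_le_add (hB' x) (hB x))
  have hσ2 : (0 : ℝ) ≤ (σ ^ 2)⁻¹ := by positivity
  calc _ ≤ ∫⁻ z, ENNReal.ofReal (σ ^ 2)⁻¹ * ENNReal.ofReal
          (hFun lo hi π γ (fun x => Q' x - Q x) z.1 z.2 ^ 2) ∂(transitionLaw lo hi d q) := by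
        refine lintegral_mono_ae ?_
        filter_upwards [ae_mem_transitionLaw hd hq] with z hz
        rw [← ENNReal.ofReal_mul hσ2]
        refine ENNReal.ofReal_le_ofReal ?_
        rw [signal, signal, if_pos hz.2, if_pos hz.2, ← sub_div,
          hFun_sub hπ hz.2 γ hQ'.measurable hQ.measurable hB' hB, div_pow,
          Real.sq_sqrt ((sq_nonneg σ).trans (hwσ _)), div_eq_inv_mul]
        exact mul_le_mul_of_nonneg_right (inv_anti₀ (by positivity) (hwσ _)) (sq_nonneg _)
    _ ≤ ENNReal.ofReal (σ ^ 2)⁻¹ * (2 * ((ENNReal.ofReal p₁ + ENNReal.ofReal p₂) *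
          ENNReal.ofReal η)) := by
        rw [lintegral_const_mul' _ _ ENNReal.ofReal_ne_top]
        gcongr
        exact hh.trans (by gcongr)
    _ = _ := by
        rw [← ENNReal.ofReal_add hp₁ hp₂, ← ENNReal.ofReal_mul (by positivity),
          ← ENNReal.ofReal_ofNat, ← ENNReal.ofReal_mul zero_le_two, ← ENNReal.ofReal_mul hσ2]

end RewardLaw

/-! ### The minimax bound from a family on the cube, and the choice of scales -/

section LowerBound

variable {m k : ℕ} {lo hi : StateAction m k} {π : State m → Action k → ℝ}
  {q : StateAction m k → State m → ℝ} {d : StateAction m k → ℝ≥0∞} {γ : ℝ}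
  {v w : StateAction m k → ℝ}

/-- The minimax lower bound for a family of functions indexed by the vertices of a cube: adjacent
functions are close in `L²`, and no function is close to two vertices that are far apart. -/
theorem minimaxProb_ge_of_family (hπ : IsPolicy lo hi π) (hq : IsTransition lo hi q)
    (hd : Measurable d) (h1 : ∫⁻ x in pairSpace lo hi, d x = 1) {p₁ p₂ : ℝ} (hp₁ : 0 ≤ p₁)
    (hp₂ : 0 ≤ p₂) (hd1 : ∀ x ∈ pairSpace lo hi, d x ≤ ENNReal.ofReal p₁)
    (hqπ : ∀ x ∈ pairSpace lo hi, ∀ s' ∈ stateSpace lo hi, ∀ a' ∈ actionSpace lo hi,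
      q x s' * π s' a' ≤ p₂)
    (hγ0 : 0 ≤ γ) (hγ1 : γ < 1) {σ : ℝ} (hσ : 0 < σ) (hw : Measurable w)
    (hwσ : ∀ x, σ ^ 2 ≤ w x) (hwi : IntegrableOn w (pairSpace lo hi))
    (hvw : ∀ x ∈ pairSpace lo hi, v x = w x) {p L : ℝ} {α : Fin m ⊕ Fin k → ℕ} {N T : ℕ} {r : ℝ}
    {J : Type} [Fintype J] [DecidableEq J] [Nonempty J] {f : (J → Bool) → StateAction m k → ℝ}
    (hf : ∀ θ, Continuous (f θ)) {B : ℝ} (hB : ∀ θ x, |f θ x| ≤ B) (hBσ : 4 * B ≤ σ)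
    (hball : ∀ θ, f θ ∈ sobolevBall (pairSpace lo hi) p L) {η : ℝ} (hη0 : 0 ≤ η)
    (hη : ∀ θ j, ∫⁻ x in pairSpace lo hi, ENNReal.ofReal ((f (flipAt j θ) x - f θ x) ^ 2) ≤
      ENNReal.ofReal η)
    (hn : ((N * T : ℕ) : ℝ) * (10 * ((σ ^ 2)⁻¹ * (2 * ((p₁ + p₂) * η)))) ≤ 1 / 2)
    (hsep : ∀ θ θ' g, derivDist (pairSpace lo hi) α g (f θ) < ENNReal.ofReal r →
      derivDist (pairSpace lo hi) α g (f θ') < ENNReal.ofReal r →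
      8 * hammingDist θ θ' ≤ Fintype.card J) :
    1 / 8 ≤ minimaxProb lo hi d q π γ v p L α N T r := by
  refine le_iInf fun Qhat => ?_
  set ρ := transitionLaw lo hi d q with hρ
  have hρp : IsProbabilityMeasure ρ := isProbabilityMeasure_transitionLaw hd hq h1
  have ht : ∀ θ, Measurable (signal lo hi π γ w (f θ)) := fun θ => measurable_signal hπ hw (hf θ)
  have hb : ∀ θ z, |signal lo hi π γ w (f θ) z| ≤ 1 / 2 := fun θ =>
    abs_signal_le hπ hγ0 hγ1 hσ hwσ (hB θ) hBσ
  have hNp : ∀ θ, IsProbabilityMeasure ((ρ.prod Measure.count).withDensity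
      fun z => ENNReal.ofReal (noiseWeight z.2 (signal lo hi π γ w (f θ) z.1))) := fun θ =>
    isProbabilityMeasure_noiseLaw ρ (ht θ) (hb θ)
  have hlaw : ∀ θ, IsModelLaw lo hi d q π γ v (f θ) (rewardLaw lo hi d q π γ w (f θ)) := fun θ =>
    isModelLaw_rewardLaw hπ hq hd h1 hd1 hγ0 hγ1 hσ hw hwσ hwi (hf θ) (hB θ) hBσ hvw
  have hlawp : ∀ θ, IsProbabilityMeasure (rewardLaw lo hi d q π γ w (f θ)) := fun θ =>
    (hlaw θ).isProbabilityMeasure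
  obtain ⟨θ, hθ⟩ := assouad
    (fun θ => Measure.pi fun _ : Fin N × Fin T => rewardLaw lo hi d q π γ w (f θ))
    (fun θ j A hA => by
      have h0 : 0 ≤ (σ ^ 2)⁻¹ * (2 * ((p₁ + p₂) * η)) := by positivity
      refine half_le_pi_add_pi_compl (measurable_noiseDensity (ht θ))
        (measurable_noiseDensity (ht (flipAt j θ))) (fun z => noiseWeight_pos z.2 (hb θ z.1))
        (fun z => (noiseWeight_pos z.2 (hb _ z.1)).le) (measurable_rewardMap hw)
        (δ := 10 * ((σ ^ 2)⁻¹ * (2 * ((p₁ + p₂) * η)))) (by positivity) ?_ ?_ hA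
      · exact lintegral_noiseWeight_sq_div_le ρ (ht θ) (ht _) (hb θ) (hb _) h0
          (lintegral_signal_sub_sq_le hπ hq hd h1 hp₁ hp₂ hd1 hqπ hγ0 hγ1 hσ hwσ (hf θ) (hf _)
            (hB θ) (hB _) (hη θ j))
      · rw [Fintype.card_prod, Fintype.card_fin, Fintype.card_fin]
        exact hn)
    (fun θ => {D | ENNReal.ofReal r ≤ derivDist (pairSpace lo hi) α (Qhat.1 D) (f θ)})
    (fun D θ θ' h h' => hsep θ θ' (Qhat.1 D) (not_le.1 h) (not_le.1 h'))
  exact hθ.trans (le_iSup₂_of_le (f θ) (hball θ)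
    (le_iSup₂_of_le (rewardLaw lo hi d q π γ w (f θ)) (hlaw θ) le_rfl))

end LowerBound

end QMinimax

open QMinimax in
theorem theorem3 {m k : ℕ} (hm : 0 < m) (hk : 0 < k)
    -- the rectangle `𝒮 × 𝒜`
    (lo hi : QMinimax.StateAction m k) (hlohi : ∀ i, lo i < hi i)
    -- initial density, policy `ν`, target policy `π`, transition density, discount factor
    (μ₀ : QMinimax.State m → ℝ) (hμ₀ : QMinimax.IsStateDensity lo hi μ₀)
    (ν π : QMinimax.State m → QMinimax.Action k → ℝ)
    (hν : QMinimax.IsPolicy lo hi ν) (hπ : QMinimax.IsPolicy lo hi π)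
    (q : QMinimax.StateAction m k → QMinimax.State m → ℝ) (hq : QMinimax.IsTransition lo hi q)
    (γ : ℝ) (hγ0 : 0 ≤ γ) (hγ1 : γ < 1)
    -- number of decision points over which the visitation density is averaged
    (H : ℕ → ℕ) (hH : ∀ T, 1 ≤ H T)
    -- coverage and absolute continuity
    (pmin p1max p2max : ℝ) (hpmin : 0 < pmin) (hp1max : 0 < p1max) (hp2max : 0 < p2max)
    (hcov : ∀ T, 1 ≤ T → ∀ x ∈ QMinimax.pairSpace lo hi,
      ENNReal.ofReal pmin ≤ QMinimax.avgVisitation lo hi μ₀ ν q (H T) x ∧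
      QMinimax.avgVisitation lo hi μ₀ ν q (H T) x ≤ ENNReal.ofReal p1max)
    (hac : QMinimax.PolicyAbsCont lo hi π ν)
    (hqπ : ∀ x ∈ QMinimax.pairSpace lo hi, ∀ s' ∈ QMinimax.stateSpace lo hi,
      ∀ a' ∈ QMinimax.actionSpace lo hi, q x s' * π s' a' ≤ p2max)
    -- smoothness, radius, multi-index, noise level
    (p L : ℝ) (hp : 0 < p) (hL : 0 < L)
    (α : Fin m ⊕ Fin k → ℕ) (hα : ((∑ i, α i : ℕ) : ℝ) < p)
    (σ : ℝ) (hσ : 0 < σ) :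
    ∃ c > 0, ∃ c' > 0, ∀ v : QMinimax.StateAction m k → ℝ, Measurable v →
      (∀ x ∈ QMinimax.pairSpace lo hi, σ ^ 2 ≤ v x) →
      IntegrableOn v (QMinimax.pairSpace lo hi) →
      ENNReal.ofReal c' ≤ Filter.liminf
        (fun n : ℕ × ℕ => QMinimax.minimaxProb lo hi
          (QMinimax.avgVisitation lo hi μ₀ ν q (H n.2)) q π γ v p L α n.1 n.2
          (c * ((n.1 * n.2 : ℕ) : ℝ) ^
            ((((∑ i, α i : ℕ) : ℝ) - p) / (2 * p + ((m + k : ℕ) : ℝ)))))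
        (Filter.comap (fun n : ℕ × ℕ => n.1 * n.2) Filter.atTop) := by
  have : Nonempty (Fin m ⊕ Fin k) := ⟨Sum.inl ⟨0, hm⟩⟩
  obtain ⟨C, hC, κ, hκ, hfam⟩ := exists_bump_family hlohi hp α
  have hcard : Fintype.card (Fin m ⊕ Fin k) = m + k := by simp
  rw [hcard] at hfam
  set A : ℕ := ∑ i, α i with hA
  set P : ℝ := 2 * p + ((m + k : ℕ) : ℝ) with hP
  have hP0 : 0 < P := by positivity
  -- the amplitude
  set V : ℝ := 10 * ((σ ^ 2)⁻¹ * (2 * ((p1max + p2max) * C))) with hV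
  have hV0 : 0 < V := by positivity
  -- The three requirements are: membership in the Sobolev ball, signals at most `1/2`, and total
  -- `χ²` budget `1/2` over all observations.
  obtain ⟨c₀, hc₀, hc₀L, hc₀σ, hc₀V⟩ : ∃ c₀ : ℝ, 0 < c₀ ∧ C * c₀ ≤ L ∧ 4 * (C * c₀) ≤ σ ∧
      V * c₀ ^ 2 ≤ 1 / 2 := by
    refine ⟨min (L / C) (min (σ / (4 * C)) (Real.sqrt (1 / (2 * V)))), by positivity, ?_, ?_, ?_⟩
    · calc _ ≤ C * (L / C) := by gcongr; exact min_le_left _ _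
        _ = L := by field_simp
    · calc _ ≤ 4 * (C * (σ / (4 * C))) := by
            gcongr; exact (min_le_right _ _).trans (min_le_left _ _)
        _ = σ := by field_simp
    · calc _ ≤ V * Real.sqrt (1 / (2 * V)) ^ 2 := by
            gcongr; exact (min_le_right _ _).trans (min_le_right _ _)
        _ = 1 / 2 := by rw [Real.sq_sqrt (by positivity)]; field_simp
  -- The factor `κ / 8` matches the radius `M ^ d / 8` in Assouad's lemma, and `2 ^ (A - p)` pays
  -- for rounding up the number of cells.
  refine ⟨Real.sqrt (κ / 8) * (c₀ * 2 ^ ((A : ℝ) - p)), by positivity, 1 / 8, by norm_num, ?_⟩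
  intro v hv hvσ hvi
  rw [show ENNReal.ofReal (1 / 8) = 1 / 8 by
    rw [ENNReal.ofReal_div_of_pos (by norm_num)]; simp]
  refine le_liminf_of_le (by isBoundedDefault) ?_
  -- The bound is not asymptotic: it holds as soon as `NT ≥ 1`.
  filter_upwards [preimage_mem_comap (Filter.Ici_mem_atTop 1)] with n hn
  have hn1 : 1 ≤ n.1 * n.2 := hn
  have hT1 : 1 ≤ n.2 := Nat.pos_of_mul_pos_left hn1
  set n' : ℝ := ((n.1 * n.2 : ℕ) : ℝ) with hn'
  have hn'1 : 1 ≤ n' := by rw [hn']; exact_mod_cast hn1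
  have hn'0 : 0 < n' := by linarith
  -- the number of cells per axis
  set R : ℝ := n' ^ (1 / P) with hR
  have hR1 : 1 ≤ R := Real.one_le_rpow hn'1 (by positivity)
  set M : ℕ := ⌈R⌉₊ with hM
  have hRM : R ≤ M := Nat.le_ceil R
  have hM1 : 1 ≤ M := by exact_mod_cast hR1.trans hRM
  have hMR : (M : ℝ) ≤ 2 * R := by
    have := (Nat.ceil_lt_add_one (by linarith : 0 ≤ R)).le
    linarith
  have hM0 : (0 : ℝ) < M := by exact_mod_cast hM1
  set a : ℝ := c₀ * (M : ℝ) ^ (-p) with ha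
  have ha0 : 0 ≤ a := by positivity
  have hac₀ : a ≤ c₀ := mul_le_of_le_one_right hc₀.le
    (Real.rpow_le_one_of_one_le_of_nonpos (by exact_mod_cast hM1) (by linarith))
  have haM : a * (M : ℝ) ^ p = c₀ := by
    rw [ha, mul_assoc, ← Real.rpow_add hM0]; simp
  obtain ⟨f, hf1, hf2, hf3, hf4, hf5⟩ := hfam M hM1 a ha0
  have : Nonempty (Fin M) := ⟨⟨0, hM1⟩⟩
  have hcardJ : (Fintype.card (Fin m ⊕ Fin k → Fin M) : ℝ) = (M : ℝ) ^ (m + k) := by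
    rw [Fintype.card_fun, Fintype.card_fin, hcard]; push_cast; rfl
  refine minimaxProb_ge_of_family hπ hq (measurable_avgVisitation hμ₀ hν hq _)
    (lintegral_avgVisitation hμ₀ hν hq (hH _)) hp1max.le hp2max.le
    -- The lower bound on `v` is known only on the rectangle; the maximum extends it everywhere
    -- without changing `v` there.
    (fun x hx => (hcov _ hT1 x hx).2) hqπ hγ0 hγ1 hσ (w := fun x => max (v x) (σ ^ 2))
    (hv.max measurable_const) (fun x => le_max_right _ _) ?_
    (fun x hx => (max_eq_left (hvσ x hx)).symm) (J := Fin m ⊕ Fin k → Fin M) (f := f) hf1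
    (B := C * a) hf2 ?_ (fun θ => hf4 θ L (by rwa [haM]))
    (η := C * a ^ 2 * ((M : ℝ) ^ (m + k))⁻¹) (by positivity) (fun θ j => ?_) ?_ ?_
  · exact hvi.congr_fun (fun x hx => (max_eq_left (hvσ x hx)).symm) measurableSet_pairSpace
  · refine le_trans ?_ hc₀σ
    gcongr
  · have h := hf3 (flipAt j θ) θ
    rw [hammingDist_comm, hammingDist_flipAt, Nat.cast_one, mul_one] at h
    exact h
  · have hMP : (M : ℝ) ^ (-p) * (M : ℝ) ^ (-p) * ((M : ℝ) ^ (m + k))⁻¹ = (M : ℝ) ^ (-P) := by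
      rw [← Real.rpow_natCast, ← Real.rpow_neg hM0.le, ← Real.rpow_add hM0, ← Real.rpow_add hM0]
      congr 1
      rw [hP]; ring
    -- This is where `M ≥ R = n' ^ (1 / P)` is used: enough cells make adjacent vertices
    -- indistinguishable.
    have hnM : n' * (M : ℝ) ^ (-P) ≤ 1 := by
      have h1 : n' = R ^ P := by
        rw [hR, ← Real.rpow_mul hn'0.le, one_div, inv_mul_cancel₀ hP0.ne', Real.rpow_one]
      rw [Real.rpow_neg hM0.le, ← div_eq_mul_inv, div_le_one (by positivity), h1]
      exact Real.rpow_le_rpow (by positivity) hRM hP0.le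
    calc n' * (10 * ((σ ^ 2)⁻¹ * (2 * ((p1max + p2max) *
          (C * a ^ 2 * ((M : ℝ) ^ (m + k))⁻¹)))))
        = V * c₀ ^ 2 * (n' * ((M : ℝ) ^ (-p) * (M : ℝ) ^ (-p) * ((M : ℝ) ^ (m + k))⁻¹)) := by
          rw [hV, ha]; ring
      _ ≤ V * c₀ ^ 2 * 1 := by
          rw [hMP]
          exact mul_le_mul_of_nonneg_left hnM (by positivity)
      _ ≤ 1 / 2 := by linarith
  · intro θ θ' g h h'
    have hr0 : 0 ≤ Real.sqrt (κ / 8) * (c₀ * 2 ^ ((A : ℝ) - p)) * n' ^ (((A : ℝ) - p) / P) := by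
      positivity
    have h8 := hf5 θ θ' g _ hr0 h h'
    set Z : ℝ := a * (M : ℝ) ^ A with hZ
    have hZ0 : 0 < Z := by positivity
    have hZr : Real.sqrt (κ / 8) * (c₀ * 2 ^ ((A : ℝ) - p)) * n' ^ (((A : ℝ) - p) / P) ≤
        Real.sqrt (κ / 8) * Z := by
      have e1 : n' ^ (((A : ℝ) - p) / P) = R ^ ((A : ℝ) - p) := by
        rw [hR, ← Real.rpow_mul hn'0.le]; congr 1; ring
      have e2 : Z = c₀ * (M : ℝ) ^ ((A : ℝ) - p) := by
        rw [hZ, ha, mul_assoc, ← Real.rpow_natCast, ← Real.rpow_add hM0]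
        congr 2; ring
      -- Here the exponent is negative, so the opposite bound `M ≤ 2 R` is needed.
      have e3 : (2 * R) ^ ((A : ℝ) - p) ≤ (M : ℝ) ^ ((A : ℝ) - p) :=
        Real.rpow_le_rpow_of_nonpos hM0 hMR (by linarith)
      rw [Real.mul_rpow zero_le_two (by positivity)] at e3
      rw [e1, e2, mul_assoc, mul_assoc]
      gcongr
    have h9 := h8.trans (pow_le_pow_left₀ hr0 hZr 2)
    rw [mul_pow _ Z, Real.sq_sqrt (by positivity)] at h9
    have hMd : (0 : ℝ) < (M : ℝ) ^ (m + k) := by positivity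
    have h10 : 8 * (hammingDist θ θ' : ℝ) ≤ (M : ℝ) ^ (m + k) := by
      have h11 : κ * Z ^ 2 * (8 * (hammingDist θ θ' : ℝ)) ≤ κ * Z ^ 2 * (M : ℝ) ^ (m + k) := by
        have h12 := mul_le_mul_of_nonneg_right h9 (by positivity : 0 ≤ 8 * (M : ℝ) ^ (m + k))
        calc _ = κ * Z ^ 2 * ((M : ℝ) ^ (m + k))⁻¹ * (hammingDist θ θ' : ℝ) *
              (8 * (M : ℝ) ^ (m + k)) := by field_simp
          _ ≤ _ := h12
          _ = _ := by ring
      exact le_of_mul_le_mul_left h11 (by positivity)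
    rw [← hcardJ] at h10
    exact_mod_cast h10
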